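/- Conventions. Manifolds are smooth, finite-dimensional, Hausdorff and second countable; submanifolds are embedded; "constant rank" means constant on each connected component. Let $(M,\pi)$ be a Poisson manifold with bracket $\{f,g\}_M=\pi(df,dg)$ and $\sharp\colon T^*M\to TM$, $\sharp\xi=\pi(\xi,\cdot)$. Let $C\subset M$ be a submanifold that is a closed subset, and $E\subset TM|_C$ a smooth vector subbundle such that $F:=E\cap TC$ is an involutive distribution of constant rank on $C$. Assume that the quotient $\underline C:=C/F$ is smooth, i.e. that the leaf space of $F$ is a manifold for which the projection $pr\colon C\to\underline C$ is a submersion whose fibres are the leaves of $F$ (so $\ker d\,pr=F$). For a family $K$ of subspaces of $TM|_C$ let $C^\infty_K(M)$ be the set of $f\in C^\infty(M)$ whose differential at points of $C$ annihilates $K$, and let $E^\circ\subset T^*M|_C$ be the annihilator of $E$. **Theorem.** Let $A\subset M$ be a submanifold containing $C$ and $D\subset TA$ a (smooth, regular) integrable, i.e. involutive, distribution on $A$ with $D|_C\subset E$. Assume that 1. $D|_C\cap TC$ has constant rank; 2. $E\cap TA|_C$ has constant rank; 3. for every vector field $Y\in\Gamma(D)$ on $A$ that is tangent to $C$ along $C$,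 the (local) flow of $Y$ preserves $E\cap TA|_C$. Assume moreover that 4. $\{C^\infty_E(M),C^\infty_E(M)\}_M\subset C^\infty_F(M)$; 5. every point of $C$ has a neighbourhood $U$ in $C$ for which there are vector fields $X_1,\dots,X_r$ on $M$ whose values at points of $A$ lie in $D$, whose restrictions to $U$ form a frame of $D|_U$, and which satisfy $(\mathcal L_{X_a}\pi)|_U\subset E\wedge TM|_C$ for all $a$; 6. $\sharp E^\circ\subset TC+D|_C$. Then $\underline C$ inherits a Poisson structure from $M$: every $f\in C^\infty(\underline C)$ has a lift $\hat f\in C^\infty_E(M)$, i.e. $\hat f|_C=pr^*f$, and there is exactly one Poisson structure on $\underline C$ such that $$pr^*\{f,g\}_{\underline C}=\{\hat f,\hat g\}_M|_C$$ for all $f,g\in C^\infty(\underline C)$ and all lifts $\hat f,\hat g\in C^\infty_E(M)$ of $f$ and $g$. -/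

import Mathlib

open Set Filter Topology
open scoped Manifold ContDiff

noncomputable section

namespace PoissonReduction

section Basic

variable {V : Type*} [NormedAddCommGroup V] [NormedSpace ℝ V]
  {M : Type*} [TopologicalSpace M] [ChartedSpace V M]

/-- Smooth real functions on `M`. -/
def SmoothFun (V : Type*) [NormedAddCommGroup V] [NormedSpace ℝ V]
    {M : Type*} [TopologicalSpace M] [ChartedSpace V M] (f : M → ℝ) : Prop :=
  ContMDiff 𝓘(ℝ, V) 𝓘(ℝ, ℝ) ∞ f

/-- Smooth vector fields on `M`. -/
def SmoothVF [IsManifold 𝓘(ℝ, V) ∞ M] (X : ∀ p : M, TangentSpace 𝓘(ℝ, V) p) : Prop :=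
  ContMDiff 𝓘(ℝ, V) 𝓘(ℝ, V).tangent ∞ (fun p => (⟨p, X p⟩ : TangentBundle 𝓘(ℝ, V) M))

/-- The cotangent space `T*_p M`, as the dual of `T_p M`. -/
abbrev Cotangent (V : Type*) [NormedAddCommGroup V] [NormedSpace ℝ V]
    {M : Type*} [TopologicalSpace M] [ChartedSpace V M] (p : M) : Type _ :=
  Module.Dual ℝ (TangentSpace 𝓘(ℝ, V) p)

/-- The differential `df` at `p`. -/
def dfun (V : Type*) [NormedAddCommGroup V] [NormedSpace ℝ V]
    {M : Type*} [TopologicalSpace M] [ChartedSpace V M] (f : M → ℝ) (p : M) : Cotangent V p :=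
  (show TangentSpace 𝓘(ℝ, V) p →L[ℝ] ℝ from mfderiv 𝓘(ℝ, V) 𝓘(ℝ, ℝ) f p).toLinearMap

/-- The function `X f`. -/
def applyVF (X : ∀ p : M, TangentSpace 𝓘(ℝ, V) p) (f : M → ℝ) : M → ℝ :=
  fun p => dfun V f p (X p)

/-- Contravariant 2-tensors at `p`, as bilinear forms on `T*_p M`; the elements of `∧² T_p M` are
those that are alternating. -/
abbrev Contra2 (V : Type*) [NormedAddCommGroup V] [NormedSpace ℝ V]
    {M : Type*} [TopologicalSpace M] [ChartedSpace V M] (p : M) : Type _ :=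
  Cotangent V p →ₗ[ℝ] Cotangent V p →ₗ[ℝ] ℝ

/-- `u ∧ v`, that is `(ξ, η) ↦ ξ(u) η(v) - ξ(v) η(u)`. -/
def wedge {p : M} (u v : TangentSpace 𝓘(ℝ, V) p) : Contra2 V p :=
  LinearMap.mk₂ ℝ (fun ξ η => ξ u * η v - ξ v * η u)
    (fun _ _ _ => by simp only [LinearMap.add_apply]; ring)
    (fun _ _ _ => by simp only [LinearMap.smul_apply, smul_eq_mul]; ring)
    (fun _ _ _ => by simp only [LinearMap.add_apply]; ring)
    (fun _ _ _ => by simp only [LinearMap.smul_apply, smul_eq_mul]; ring)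

/-- The subspace `K ∧ T_p M` of `∧² T_p M`, for a subspace `K` of `T_p M`. -/
def wedgeTangent {p : M} (K : Submodule ℝ (TangentSpace 𝓘(ℝ, V) p)) :
    Submodule ℝ (Contra2 V p) :=
  Submodule.span ℝ {w | ∃ u ∈ K, ∃ v : TangentSpace 𝓘(ℝ, V) p, w = wedge u v}

/-- `{f, g} = π(df, dg)`. -/
def bracket (π : ∀ p : M, Contra2 V p) (f g : M → ℝ) : M → ℝ :=
  fun p => π p (dfun V f p) (dfun V g p)

/-- A Poisson structure on `M`: a smooth bivector field whose bracket satisfies the Jacobi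
identity (equivalently, whose Schouten square is zero). -/
structure PoissonStructure (V : Type*) [NormedAddCommGroup V] [NormedSpace ℝ V]
    (M : Type*) [TopologicalSpace M] [ChartedSpace V M] where
  /-- the bivector field -/
  bivector : ∀ p : M, Contra2 V p
  alternating : ∀ p, (bivector p).IsAlt
  smooth : ∀ f g : M → ℝ, SmoothFun V f → SmoothFun V g → SmoothFun V (bracket bivector f g)
  jacobi : ∀ f g h : M → ℝ, SmoothFun V f → SmoothFun V g → SmoothFun V h → ∀ p,
    bracket bivector (bracket bivector f g) h p + bracket bivector (bracket bivector g h) f p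
      + bracket bivector (bracket bivector h f) g p = 0

/-- The value of `L_X π` on `df, dg`, by the Leibniz rule
`X (π(df, dg)) = (L_X π)(df, dg) + π(d(X f), dg) + π(df, d(X g))`. -/
def lieDerivOnFun (X : ∀ p : M, TangentSpace 𝓘(ℝ, V) p) (π : ∀ p : M, Contra2 V p)
    (f g : M → ℝ) : M → ℝ :=
  fun p => applyVF X (bracket π f g) p - bracket π (applyVF X f) g p - bracket π f (applyVF X g) p

/-- `Λ` is the value at `p` of the bivector field `L_X π`. -/
def IsLieDerivAt (X : ∀ p : M, TangentSpace 𝓘(ℝ, V) p) (π : ∀ p : M, Contra2 V p)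
    (p : M) (Λ : Contra2 V p) : Prop :=
  ∀ f g : M → ℝ, SmoothFun V f → SmoothFun V g →
    Λ (dfun V f p) (dfun V g p) = lieDerivOnFun X π f g p

instance instFiniteDimensionalTangent [FiniteDimensional ℝ V] (p : M) :
    FiniteDimensional ℝ (TangentSpace 𝓘(ℝ, V) p) :=
  inferInstanceAs (FiniteDimensional ℝ V)

/-- `♯ξ = π(ξ, ·)`, as an element of `T_p M = (T*_p M)*`. -/
def sharp [FiniteDimensional ℝ V] (π : ∀ p : M, Contra2 V p) (p : M) (ξ : Cotangent V p) :
    TangentSpace 𝓘(ℝ, V) p :=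
  (Module.evalEquiv ℝ (TangentSpace 𝓘(ℝ, V) p)).symm (π p ξ)

/-- The distribution `D` on `M` is involutive: its sections are closed under the Lie bracket. -/
def IsInvolutive [IsManifold 𝓘(ℝ, V) ∞ M]
    (D : ∀ p : M, Submodule ℝ (TangentSpace 𝓘(ℝ, V) p)) : Prop :=
  ∀ X Y : (∀ p : M, TangentSpace 𝓘(ℝ, V) p), SmoothVF X → SmoothVF Y →
    (∀ p, X p ∈ D p) → (∀ p, Y p ∈ D p) →
      ∀ p, VectorField.mlieBracket 𝓘(ℝ, V) X Y p ∈ D p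

/-- `Φ`, restricted to the open set `W`, is a smooth local flow of the vector field `Y`. -/
structure IsLocalFlow (Y : ∀ p : M, TangentSpace 𝓘(ℝ, V) p) (W : Set (ℝ × M))
    (Φ : ℝ × M → M) : Prop where
  isOpen : IsOpen W
  smoothOn : ContMDiffOn (𝓘(ℝ, ℝ).prod 𝓘(ℝ, V)) 𝓘(ℝ, V) ∞ Φ W
  ordConnected : ∀ p, {t : ℝ | (t, p) ∈ W}.OrdConnected
  zero_mem : ∀ t p, (t, p) ∈ W → ((0 : ℝ), p) ∈ W
  map_zero : ∀ p, ((0 : ℝ), p) ∈ W → Φ (0, p) = p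
  integralCurve : ∀ p, IsMIntegralCurveOn (I := 𝓘(ℝ, V)) (fun t => Φ (t, p)) Y
    {t : ℝ | (t, p) ∈ W}

/-- The elementary step of the leaf relation of `F`: a smooth curve tangent to `F` joins `x`
to `y`. -/
def JoinedAlong (F : ∀ p : M, Submodule ℝ (TangentSpace 𝓘(ℝ, V) p)) (x y : M) : Prop :=
  ∃ γ : ℝ → M, ContMDiff 𝓘(ℝ, ℝ) 𝓘(ℝ, V) ∞ γ ∧ γ 0 = x ∧ γ 1 = y ∧
    ∀ t : ℝ, mfderiv 𝓘(ℝ, ℝ) 𝓘(ℝ, V) γ t (1 : ℝ) ∈ F (γ t)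

/-- `x` and `y` lie on the same leaf of `F`: they are joined by a finite chain of smooth curves
tangent to `F`. -/
def SameLeaf (F : ∀ p : M, Submodule ℝ (TangentSpace 𝓘(ℝ, V) p)) : M → M → Prop :=
  Relation.EqvGen (JoinedAlong F)

end Basic

section AlongMap

variable {V : Type*} [NormedAddCommGroup V] [NormedSpace ℝ V]
  {M : Type*} [TopologicalSpace M] [ChartedSpace V M]
  {V' : Type*} [NormedAddCommGroup V'] [NormedSpace ℝ V']
  {C : Type*} [TopologicalSpace C] [ChartedSpace V' C]

/-- `E`, a family of subspaces `E c` of `T_{j c} M`, is a smooth vector subbundle of `j* TM`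
(for a submanifold `j`: a smooth subbundle of `TM|_C`): it has a smooth frame near every point. -/
def IsSmoothSubbundle (V' : Type*) [NormedAddCommGroup V'] [NormedSpace ℝ V']
    {C : Type*} [TopologicalSpace C] [ChartedSpace V' C] [IsManifold 𝓘(ℝ, V) ∞ M] (j : C → M)
    (E : ∀ c : C, Submodule ℝ (TangentSpace 𝓘(ℝ, V) (j c))) : Prop :=
  ∀ c₀ : C, ∃ U : Set C, IsOpen U ∧ c₀ ∈ U ∧
    ∃ (r : ℕ) (s : Fin r → ∀ c : C, TangentSpace 𝓘(ℝ, V) (j c)),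
      (∀ a, ContMDiffOn 𝓘(ℝ, V') 𝓘(ℝ, V).tangent ∞
        (fun c => (⟨j c, s a c⟩ : TangentBundle 𝓘(ℝ, V) M)) U) ∧
      ∀ c ∈ U, LinearIndependent ℝ (fun a => s a c) ∧
        Submodule.span ℝ (Set.range fun a => s a c) = E c

/-- `TC` as a family of subspaces of `TM`, for a submanifold `j : C → M`. -/
def tangentImage (V V' : Type*) [NormedAddCommGroup V] [NormedSpace ℝ V]
    [NormedAddCommGroup V'] [NormedSpace ℝ V']
    {M : Type*} [TopologicalSpace M] [ChartedSpace V M]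
    {C : Type*} [TopologicalSpace C] [ChartedSpace V' C] (j : C → M) (c : C) :
    Submodule ℝ (TangentSpace 𝓘(ℝ, V) (j c)) :=
  (mfderiv 𝓘(ℝ, V') 𝓘(ℝ, V) j c).toLinearMap.range

/-- The image in `TM` of a distribution `D` on a submanifold `k : A → M`. -/
def pushSubspace (k : C → M) (D : ∀ a : C, Submodule ℝ (TangentSpace 𝓘(ℝ, V') a)) (a : C) :
    Submodule ℝ (TangentSpace 𝓘(ℝ, V) (k a)) :=
  (D a).map (mfderiv 𝓘(ℝ, V') 𝓘(ℝ, V) k a).toLinearMap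

/-- The distribution `E ∩ TC` on `C`, for a submanifold `j : C → M` and `E` in `TM|_C`. -/
def intersectTangent (V' : Type*) [NormedAddCommGroup V'] [NormedSpace ℝ V']
    {C : Type*} [TopologicalSpace C] [ChartedSpace V' C] (j : C → M)
    (E : ∀ c : C, Submodule ℝ (TangentSpace 𝓘(ℝ, V) (j c))) (c : C) :
    Submodule ℝ (TangentSpace 𝓘(ℝ, V') c) :=
  (E c).comap (mfderiv 𝓘(ℝ, V') 𝓘(ℝ, V) j c).toLinearMap

/-- The set `C^∞_E(M)` of smooth functions on `M` whose differential at points of `C`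
annihilates `E`. -/
def AdaptedFun (j : C → M) (E : ∀ c : C, Submodule ℝ (TangentSpace 𝓘(ℝ, V) (j c))) :
    Set (M → ℝ) :=
  {f | SmoothFun V f ∧ ∀ c, dfun V f (j c) ∈ (E c).dualAnnihilator}

/-- The total space of `E`, as a subset of the tangent bundle of `M`. -/
def totalSpace (j : C → M) (E : ∀ c : C, Submodule ℝ (TangentSpace 𝓘(ℝ, V) (j c))) :
    Set (TangentBundle 𝓘(ℝ, V) M) :=
  {w | ∃ c : C, ∃ v ∈ E c, w = ⟨j c, v⟩}

/-- `pr : C → N` exhibits the manifold `N` as the smooth quotient of `C` by the foliation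
integrating `F`: `pr` is a surjective submersion, its fibres are the leaves of `F` as sets, and
the tangent spaces of the fibres are given by `F`. -/
structure IsLeafSpace (F : ∀ c : C, Submodule ℝ (TangentSpace 𝓘(ℝ, V') c)) (pr : C → M) :
    Prop where
  surjective : Function.Surjective pr
  submersion : Manifold.IsSubmersion 𝓘(ℝ, V') 𝓘(ℝ, V) ∞ pr
  fibre : ∀ x y, pr x = pr y ↔ SameLeaf F x y
  ker_eq : ∀ c, (mfderiv 𝓘(ℝ, V') 𝓘(ℝ, V) pr c).toLinearMap.ker = F c

end AlongMap

/-- For submanifolds `i : C → A` and `k : A → M`, a distribution `D` on `A` and `E` in `TM|_C`: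
the flow of every vector field `Y ∈ Γ(D)` on `A` that is tangent to `C` along `C`
preserves `E ∩ TA|_C`. -/
def FlowsPreserve {V : Type*} [NormedAddCommGroup V] [NormedSpace ℝ V]
    {M : Type*} [TopologicalSpace M] [ChartedSpace V M]
    {VA : Type*} [NormedAddCommGroup VA] [NormedSpace ℝ VA]
    {A : Type*} [TopologicalSpace A] [ChartedSpace VA A] [IsManifold 𝓘(ℝ, VA) ∞ A]
    (VC : Type*) [NormedAddCommGroup VC] [NormedSpace ℝ VC]
    {C : Type*} [TopologicalSpace C] [ChartedSpace VC C]
    (i : C → A) (k : A → M)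
    (D : ∀ a : A, Submodule ℝ (TangentSpace 𝓘(ℝ, VA) a))
    (E : ∀ c : C, Submodule ℝ (TangentSpace 𝓘(ℝ, V) (k (i c)))) : Prop :=
  ∀ Y : (∀ a : A, TangentSpace 𝓘(ℝ, VA) a), SmoothVF Y → (∀ a, Y a ∈ D a) →
    (∀ c, Y (i c) ∈ tangentImage VA VC i c) →
    ∀ (W : Set (ℝ × A)) (Φ : ℝ × A → A), IsLocalFlow Y W Φ →
      ∀ (t : ℝ) (w : TangentBundle 𝓘(ℝ, VA) A), (t, w.1) ∈ W →
        tangentMap 𝓘(ℝ, VA) 𝓘(ℝ, V) k w ∈ totalSpace (k ∘ i) E →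
        tangentMap 𝓘(ℝ, VA) 𝓘(ℝ, V) k
          (tangentMap 𝓘(ℝ, VA) 𝓘(ℝ, VA) (fun a => Φ (t, a)) w) ∈
            totalSpace (k ∘ i) E

end PoissonReduction

end

open PoissonReduction

/-!
The bracket on the quotient is computed with lifts in `C^∞_E(M)`, and everything rests on one
pointwise observation (`bivector_apply_eq_zero`): if `ξ ∈ E°` and `η` annihilates `TC` and `D`, then
`π(ξ, η) = η(♯ξ) = 0`, because `♯E° ⊆ TC + D`.

*Lifts* (`exists_adaptedFun_lift`). A function pulled back from the quotient has a differential that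
annihilates `E ∩ TC`, so prescribing it on `C`, and the differential zero on `E`, is consistent.
Locally one corrects an arbitrary extension by `∑ i, θ i * y i`, where the `y i` vanish on `C`; the
coefficients solve a linear system along `C` whose rank is `rank E - rank (E ∩ TC)`, hence locally
constant, hence solvable smoothly (`exists_smooth_solution`). A partition of unity glues the local
lifts since they agree on `C`.

*The bracket descends.* Since `D ⊆ E`, the observation shows that `{f', g'}` restricted to `C` does
not depend on the lifts `f'`, `g'`. Its differential annihilates `E ∩ TC`, so it is constant on
leaves, and it is smooth on the quotient because submersions have local sections. The bivector of
the quotient at a point comes from a linear choice of covectors in `E°` lifting the covectors of the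
quotient.

*Jacobi.* The bracket `{f', g'}` need not lie in `C^∞_E(M)`, but by the observation it may replace
an adapted lift of `{f, g}` inside `{·, h'}` at a point `c` as soon as its differential annihilates
`D` at `c`. As the bracket does not depend on the lifts, they may be chosen for the given `c`. Let
`X a` be the given frame of `D` near `c`. If `X b (X a f')` and `X b (X a g')` vanish at `c` for
all `a`, `b`, the Leibniz rule for the Lie derivative of `π`, together with the observation, gives
`X a {f', g'} = {X a f', g'} + {f', X a g'} = 0` at `c` (`dfun_bracket_apply_eq_zero`). Such lifts
exist (`exists_adaptedFun_secondDeriv_eq_zero`): the matrix of the `X b (X a f')` at `c` is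
symmetric, because `D` is involutive and `df'` annihilates `D` along `C`, and it vanishes in
directions tangent to `C`, because `X a f' = 0` on `C`. So it is the Hessian of a quadratic
expression in functions vanishing on `C`, which can be subtracted from `f'` without affecting
values and first derivatives along `C`.
-/

namespace PoissonReduction

section Differential

variable {V : Type*} [NormedAddCommGroup V] [NormedSpace ℝ V]
  {M : Type*} [TopologicalSpace M] [ChartedSpace V M]
  {V' : Type*} [NormedAddCommGroup V'] [NormedSpace ℝ V']
  {C : Type*} [TopologicalSpace C] [ChartedSpace V' C]

/-! ### Differentials of functions -/

theorem SmoothFun.mdifferentiableAt {f : M → ℝ} (hf : SmoothFun V f) (p : M) :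
    MDifferentiableAt 𝓘(ℝ, V) 𝓘(ℝ, ℝ) f p :=
  ContMDiff.mdifferentiableAt hf (by simp)

theorem SmoothFun.const (a : ℝ) : SmoothFun V (fun _ : M => a) := contMDiff_const

theorem SmoothFun.add {f g : M → ℝ} (hf : SmoothFun V f) (hg : SmoothFun V g) :
    SmoothFun V (fun m => f m + g m) := ContMDiff.add hf hg

theorem SmoothFun.sub {f g : M → ℝ} (hf : SmoothFun V f) (hg : SmoothFun V g) :
    SmoothFun V (fun m => f m - g m) := ContMDiff.sub hf hg

theorem SmoothFun.mul {f g : M → ℝ} (hf : SmoothFun V f) (hg : SmoothFun V g) :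
    SmoothFun V (fun m => f m * g m) := ContMDiff.mul hf hg

theorem SmoothFun.sum {ι : Type*} (s : Finset ι) {f : ι → M → ℝ} (hf : ∀ i, SmoothFun V (f i)) :
    SmoothFun V (fun m => ∑ i ∈ s, f i m) := by
  classical
  induction s using Finset.induction_on with
  | empty => simpa using SmoothFun.const 0
  | insert a s ha ih =>
    simp only [Finset.sum_insert ha]
    exact (hf a).add ih

theorem dfun_congr {f g : M → ℝ} {p : M} (h : f =ᶠ[𝓝 p] g) : dfun V f p = dfun V g p := by
  have : mfderiv 𝓘(ℝ, V) 𝓘(ℝ, ℝ) f p = mfderiv 𝓘(ℝ, V) 𝓘(ℝ, ℝ) g p := h.mfderiv_eq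
  ext v
  exact congrArg (fun L : TangentSpace 𝓘(ℝ, V) p →L[ℝ] ℝ => L v) this

theorem dfun_const (a : ℝ) (p : M) : dfun V (fun _ : M => a) p = 0 := by
  ext v
  exact congrArg (fun L : TangentSpace 𝓘(ℝ, V) p →L[ℝ] ℝ => L v)
    (mvfderiv_const (I := 𝓘(ℝ, V)) (𝕜 := ℝ) a (x := p))

theorem dfun_add {f g : M → ℝ} {p : M} (hf : MDifferentiableAt 𝓘(ℝ, V) 𝓘(ℝ, ℝ) f p)
    (hg : MDifferentiableAt 𝓘(ℝ, V) 𝓘(ℝ, ℝ) g p) :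
    dfun V (fun x => f x + g x) p = dfun V f p + dfun V g p := by
  ext v
  exact congrArg (fun L : TangentSpace 𝓘(ℝ, V) p →L[ℝ] ℝ => L v) (mvfderiv_add hf hg)

theorem dfun_sub {f g : M → ℝ} {p : M} (hf : MDifferentiableAt 𝓘(ℝ, V) 𝓘(ℝ, ℝ) f p)
    (hg : MDifferentiableAt 𝓘(ℝ, V) 𝓘(ℝ, ℝ) g p) :
    dfun V (fun x => f x - g x) p = dfun V f p - dfun V g p := by
  ext v
  exact congrArg (fun L : TangentSpace 𝓘(ℝ, V) p →L[ℝ] ℝ => L v) (mvfderiv_sub hf hg)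

theorem dfun_mul {f g : M → ℝ} {p : M} (hf : MDifferentiableAt 𝓘(ℝ, V) 𝓘(ℝ, ℝ) f p)
    (hg : MDifferentiableAt 𝓘(ℝ, V) 𝓘(ℝ, ℝ) g p) :
    dfun V (fun x => f x * g x) p = f p • dfun V g p + g p • dfun V f p := by
  ext v
  exact congrArg (fun L : TangentSpace 𝓘(ℝ, V) p →L[ℝ] ℝ => L v) (mvfderiv_mul hf hg)

theorem dfun_sum {ι : Type*} (s : Finset ι) {f : ι → M → ℝ} {p : M}
    (hf : ∀ i ∈ s, MDifferentiableAt 𝓘(ℝ, V) 𝓘(ℝ, ℝ) (f i) p) :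
    MDifferentiableAt 𝓘(ℝ, V) 𝓘(ℝ, ℝ) (fun x => ∑ i ∈ s, f i x) p ∧
      dfun V (fun x => ∑ i ∈ s, f i x) p = ∑ i ∈ s, dfun V (f i) p := by
  classical
  induction s using Finset.induction_on with
  | empty => simpa using ⟨mdifferentiableAt_const, dfun_const 0 p⟩
  | insert a s ha ih =>
    obtain ⟨h1, h2⟩ := ih fun i hi => hf i (Finset.mem_insert_of_mem hi)
    have h0 := hf a (Finset.mem_insert_self a s)
    simp only [Finset.sum_insert ha]
    exact ⟨h0.add h1, by rw [dfun_add h0 h1, h2]⟩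

theorem dfun_comp {f : M → ℝ} {j : C → M} {c : C}
    (hf : MDifferentiableAt 𝓘(ℝ, V) 𝓘(ℝ, ℝ) f (j c))
    (hj : MDifferentiableAt 𝓘(ℝ, V') 𝓘(ℝ, V) j c) (v : TangentSpace 𝓘(ℝ, V') c) :
    dfun V' (fun x => f (j x)) c v = dfun V f (j c) (mfderiv 𝓘(ℝ, V') 𝓘(ℝ, V) j c v) :=
  mfderiv_comp_apply c hf hj v

theorem dfun_comp_curve {f : M → ℝ} {γ : ℝ → M} {t : ℝ}
    (hf : MDifferentiableAt 𝓘(ℝ, V) 𝓘(ℝ, ℝ) f (γ t))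
    (hγ : MDifferentiableAt 𝓘(ℝ, ℝ) 𝓘(ℝ, V) γ t) :
    HasDerivAt (fun s => f (γ s)) (dfun V f (γ t) (mfderiv 𝓘(ℝ, ℝ) 𝓘(ℝ, V) γ t (1 : ℝ))) t := by
  have h := hasMFDerivAt_iff_hasFDerivAt.1 (hf.hasMFDerivAt.comp t hγ.hasMFDerivAt)
  exact HasFDerivAt.hasDerivAt (𝕜 := ℝ) (F := ℝ) h

/-- Multiplying a function that is smooth near `p` by a bump function makes it globally smooth.
The last clause records that this creates no new non-zeros, so that a function vanishing on a
subset near `p` is globalised to a function vanishing on all of that subset. -/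
theorem exists_smoothFun_eventuallyEq [FiniteDimensional ℝ V] [T2Space M]
    [IsManifold 𝓘(ℝ, V) ∞ M] {p : M} {O : Set M} (hO : IsOpen O) (hp : p ∈ O) {f : M → ℝ}
    (hf : ContMDiffOn 𝓘(ℝ, V) 𝓘(ℝ, ℝ) ∞ f O) :
    ∃ g : M → ℝ, SmoothFun V g ∧ g =ᶠ[𝓝 p] f ∧ ∀ m, (m ∈ O → f m = 0) → g m = 0 := by
  obtain ⟨χ, hχ⟩ := ((SmoothBumpFunction.nhds_basis_tsupport (I := 𝓘(ℝ, V)) p).mem_iff).1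
    (hO.mem_nhds hp)
  refine ⟨fun m => χ m * f m, ?_, ?_, ?_⟩
  · refine contMDiff_of_tsupport fun m hm => ?_
    have hm' : m ∈ O := hχ.2 (closure_mono (Function.support_mul_subset_left _ _) hm)
    exact χ.contMDiffAt.mul ((hf m hm').contMDiffAt (hO.mem_nhds hm'))
  · filter_upwards [χ.eventuallyEq_one] with m hm
    simp [hm]
  · intro m hm
    by_cases h : m ∈ O
    · simp [hm h]
    · have : χ m = 0 := by
        by_contra h'
        exact h (hχ.2 (subset_tsupport _ h'))
      simp [this]

theorem dfun_eq_fderiv (f : V → ℝ) (z w : V) : dfun V f z w = fderiv ℝ f z w := by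
  change mfderiv 𝓘(ℝ, V) 𝓘(ℝ, ℝ) f z w = _
  rw [mfderiv_eq_fderiv]
  rfl

/-- Every covector is the differential of a globally smooth function. -/
theorem exists_smoothFun_dfun_eq [FiniteDimensional ℝ V] [T2Space M]
    [IsManifold 𝓘(ℝ, V) ∞ M] (p : M) (ξ : Cotangent V p) :
    ∃ f : M → ℝ, SmoothFun V f ∧ dfun V f p = ξ := by
  have hinv : (mfderiv 𝓘(ℝ, V) 𝓘(ℝ, V) (extChartAt 𝓘(ℝ, V) p) p).IsInvertible :=
    isInvertible_mfderiv_extChartAt (mem_extChartAt_source p)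
  let L : V →L[ℝ] ℝ :=
    LinearMap.toContinuousLinearMap (E := V) (𝕜 := ℝ) (F' := ℝ)
      (ξ ∘ₗ (mfderiv 𝓘(ℝ, V) 𝓘(ℝ, V) (extChartAt 𝓘(ℝ, V) p) p).inverse.toLinearMap)
  have hchart : ContMDiffOn 𝓘(ℝ, V) 𝓘(ℝ, V) ∞ (extChartAt 𝓘(ℝ, V) p) (chartAt V p).source :=
    contMDiffOn_extChartAt
  obtain ⟨f, hf, hfL, -⟩ := exists_smoothFun_eventuallyEq (p := p) (chartAt V p).open_source
    (mem_chart_source V p) (f := fun m => L (extChartAt 𝓘(ℝ, V) p m))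
    (L.contMDiff.comp_contMDiffOn hchart)
  refine ⟨f, hf, ?_⟩
  rw [dfun_congr hfL]
  ext v
  have hL : MDifferentiableAt 𝓘(ℝ, V) 𝓘(ℝ, ℝ) L (extChartAt 𝓘(ℝ, V) p p) :=
    L.contMDiff.mdifferentiableAt (by simp) (n := ∞)
  rw [dfun_comp hL (mdifferentiableAt_extChartAt (mem_chart_source V p))]
  have h1 : ∀ w : V, dfun V (L : V → ℝ) (extChartAt 𝓘(ℝ, V) p p) w = L w := fun w => by
    rw [dfun_eq_fderiv, L.fderiv]
  refine (h1 _).trans ?_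
  change ξ _ = _
  exact congrArg ξ (congrArg (fun T : TangentSpace 𝓘(ℝ, V) p →L[ℝ] TangentSpace 𝓘(ℝ, V) p => T v)
    hinv.inverse_comp_self)

/-! ### Vector fields as derivations -/

/-- The derivative of a smooth function along a smooth section of a pulled back tangent bundle. -/
theorem contMDiffOn_dfun_section [IsManifold 𝓘(ℝ, V) ∞ M] {f : M → ℝ} (hf : SmoothFun V f)
    {j : C → M} {s : ∀ c : C, TangentSpace 𝓘(ℝ, V) (j c)} {U : Set C}
    (hs : ContMDiffOn 𝓘(ℝ, V') 𝓘(ℝ, V).tangent ∞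
      (fun c => (⟨j c, s c⟩ : TangentBundle 𝓘(ℝ, V) M)) U) :
    ContMDiffOn 𝓘(ℝ, V') 𝓘(ℝ, ℝ) ∞ (fun c => dfun V f (j c) (s c)) U :=
  (contMDiff_snd_tangentBundle_modelSpace ℝ 𝓘(ℝ, ℝ)).comp_contMDiffOn
    ((ContMDiff.contMDiff_tangentMap (m := ∞) hf (by simp)).comp_contMDiffOn hs)

theorem SmoothVF.applyVF [IsManifold 𝓘(ℝ, V) ∞ M] {X : ∀ p : M, TangentSpace 𝓘(ℝ, V) p}
    (hX : SmoothVF X) {f : M → ℝ} (hf : SmoothFun V f) : SmoothFun V (applyVF X f) :=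
  contMDiffOn_univ.1 (contMDiffOn_dfun_section (j := id) hf (ContMDiff.contMDiffOn hX))

open VectorField in
/-- The Lie bracket of vector fields acts on functions as the commutator of derivations. -/
theorem dfun_mlieBracket [IsManifold 𝓘(ℝ, V) ∞ M] [CompleteSpace V]
    {X Y : ∀ p : M, TangentSpace 𝓘(ℝ, V) p}
    (hX : SmoothVF X) (hY : SmoothVF Y) {f : M → ℝ} (hf : SmoothFun V f) (p : M) :
    dfun V f p (mlieBracket 𝓘(ℝ, V) X Y p) =
      applyVF X (applyVF Y f) p - applyVF Y (applyVF X f) p := by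
  have hM2 : IsManifold 𝓘(ℝ, V) 2 M := .of_le (n := ∞) ENat.LEInfty.out
  set φ := extChartAt 𝓘(ℝ, V) p with hφ
  set z := φ p with hz
  have hzt : z ∈ φ.target := mem_extChartAt_target p
  have hsymm : φ.symm z = p := extChartAt_to_inv p
  have htarget : φ.target ∈ 𝓝 z := extChartAt_target_mem_nhds p
  have hφs : ∀ z' ∈ φ.target, MDifferentiableAt 𝓘(ℝ, V) 𝓘(ℝ, V) φ.symm z' := fun z' hz' =>
    ((contMDiffOn_extChartAt_symm (n := 2) p z' hz').contMDiffAt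
      ((isOpen_extChartAt_target p).mem_nhds hz')).mdifferentiableAt (by simp)
  -- `loc Z` is the vector field `Z` in the chart
  let loc : (∀ q : M, TangentSpace 𝓘(ℝ, V) q) → V → V := fun Z =>
    mpullbackWithin 𝓘(ℝ, V) 𝓘(ℝ, V) φ.symm Z (range 𝓘(ℝ, V))
  have hloc : ∀ (Z : ∀ q : M, TangentSpace 𝓘(ℝ, V) q) (h : M → ℝ), SmoothFun V h →
      ∀ z' ∈ φ.target,
        applyVF Z h (φ.symm z') = fderiv ℝ (fun y => h (φ.symm y)) z' (loc Z z') := by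
    intro Z h hh z' hz'
    have h1 := dfun_comp (V' := V) (f := h) (hh.mdifferentiableAt (φ.symm z')) (hφs z' hz')
      (loc Z z')
    have h2 : mfderiv 𝓘(ℝ, V) 𝓘(ℝ, V) φ.symm z' (loc Z z') = Z (φ.symm z') := by
      have hi := isInvertible_mfderivWithin_extChartAt_symm hz'
      have := hi.self_comp_inverse
      rw [← mfderivWithin_univ, ← ModelWithCorners.range_eq_univ 𝓘(ℝ, V)]
      exact congrArg (fun T : TangentSpace 𝓘(ℝ, V) (φ.symm z') →L[ℝ]
        TangentSpace 𝓘(ℝ, V) (φ.symm z') => T (Z (φ.symm z'))) this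
    rw [h2] at h1
    change dfun V h (φ.symm z') (Z (φ.symm z')) = _
    rw [← h1]
    exact dfun_eq_fderiv _ _ _
  have hdiff : ∀ Z : (∀ q : M, TangentSpace 𝓘(ℝ, V) q), SmoothVF Z →
      DifferentiableAt ℝ (loc Z) z := by
    intro Z hZ
    have h1 : DifferentiableWithinAt ℝ (loc Z) (φ.symm ⁻¹' univ ∩ range 𝓘(ℝ, V)) z :=
      MDifferentiableWithinAt.differentiableWithinAt_mpullbackWithin_vectorField
        (s := univ) (x := p) (V := Z) (I := 𝓘(ℝ, V))
      (ContMDiff.mdifferentiable hZ (by simp) p).mdifferentiableWithinAt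
    rwa [preimage_univ, univ_inter, ModelWithCorners.range_eq_univ,
      differentiableWithinAt_univ] at h1
  set g : V → ℝ := fun y => f (φ.symm y) with hg
  -- the symmetric second derivative of `g` cancels in the commutator
  have hgC : ContDiffAt ℝ 2 g z := by
    have h1 : ContMDiffAt 𝓘(ℝ, V) 𝓘(ℝ, ℝ) 2 g z :=
      (ContMDiff.of_le hf ENat.LEInfty.out (φ.symm z)).comp z
        ((contMDiffOn_extChartAt_symm (n := 2) p z hzt).contMDiffAt htarget)
    exact contMDiffAt_iff_contDiffAt.1 h1
  have hg1 : DifferentiableAt ℝ (fderiv ℝ g) z :=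
    (hgC.fderiv_right (m := 1) (by norm_num)).differentiableAt (by simp)
  have hsecond : ∀ Z W : (∀ q : M, TangentSpace 𝓘(ℝ, V) q), SmoothVF Z → SmoothVF W →
      applyVF Z (applyVF W f) p = fderiv ℝ (fderiv ℝ g) z (loc Z z) (loc W z)
        + fderiv ℝ g z (fderiv ℝ (loc W) z (loc Z z)) := by
    intro Z W hZ hW
    have h1 := hloc Z _ (hW.applyVF hf) z hzt
    have h2 : (fun y => applyVF W f (φ.symm y)) =ᶠ[𝓝 z] fun y => fderiv ℝ g y (loc W y) := by
      filter_upwards [htarget] with y hy using hloc W f hf y hy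
    rw [hsymm] at h1
    rw [h1, h2.fderiv_eq, fderiv_clm_apply hg1 (hdiff W hW)]
    simp [add_comm]
  let B : V := lieBracket ℝ (loc X) (loc Y) z
  have hbr : dfun V f p (mlieBracket 𝓘(ℝ, V) X Y p) =
      fderiv ℝ g z B := by
    have hinv : (mfderiv 𝓘(ℝ, V) 𝓘(ℝ, V) φ p).IsInvertible :=
      isInvertible_mfderiv_extChartAt (mem_extChartAt_source p)
    have h0 : mlieBracket 𝓘(ℝ, V) X Y p = (mfderiv 𝓘(ℝ, V) 𝓘(ℝ, V) φ p).inverse B := by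
      have h1 : lieBracketWithin ℝ (loc X) (loc Y) (φ.symm ⁻¹' univ ∩ range 𝓘(ℝ, V)) z = B := by
        rw [preimage_univ, univ_inter, ModelWithCorners.range_eq_univ, lieBracketWithin_univ]
      rw [← mlieBracketWithin_univ, mlieBracketWithin_apply]
      exact congrArg (fun w => (mfderiv 𝓘(ℝ, V) 𝓘(ℝ, V) φ p).inverse w) h1
    have h1 : mfderiv 𝓘(ℝ, V) 𝓘(ℝ, V) φ p (mlieBracket 𝓘(ℝ, V) X Y p) = B := by
      rw [h0]
      exact congrArg (fun T : V →L[ℝ] V => T B)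
        hinv.self_comp_inverse
    have h2 : f =ᶠ[𝓝 p] fun m => g (φ m) := by
      filter_upwards [extChartAt_source_mem_nhds (I := 𝓘(ℝ, V)) p] with m hm
      simp only [hg, φ.left_inv hm]
    rw [dfun_congr h2]
    refine (dfun_comp (V := V) (f := g) (j := φ)
      (hgC.differentiableAt (by simp)).mdifferentiableAt
      (mdifferentiableAt_extChartAt (mem_chart_source V p)) _).trans ?_
    exact (congrArg (fun w => dfun V g z w) h1).trans (dfun_eq_fderiv _ _ _)
  have hsym : fderiv ℝ (fderiv ℝ g) z (loc X z) (loc Y z) =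
      fderiv ℝ (fderiv ℝ g) z (loc Y z) (loc X z) :=
    (hgC.isSymmSndFDerivAt (by simp)).eq _ _
  rw [hbr, hsecond X Y hX hY, hsecond Y X hY hX, hsym]
  simp only [B, lieBracket, map_sub]
  ring

end Differential

section Retraction

variable {V : Type*} [NormedAddCommGroup V] [NormedSpace ℝ V]
  {M : Type*} [TopologicalSpace M] [ChartedSpace V M]
  {V' : Type*} [NormedAddCommGroup V'] [NormedSpace ℝ V']
  {C : Type*} [TopologicalSpace C] [ChartedSpace V' C]

/-! ### Local retractions and local sections -/

/-- The map `j : C → M` is smooth and near every point of its image there is a smooth retraction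
of `M` onto `C`. This is the form in which embeddedness is used: unlike the normal form of an
immersion in charts, it is visibly stable under composition. -/
structure HasLocalRetractions (V V' : Type*) [NormedAddCommGroup V] [NormedSpace ℝ V]
    [NormedAddCommGroup V'] [NormedSpace ℝ V']
    {M : Type*} [TopologicalSpace M] [ChartedSpace V M]
    {C : Type*} [TopologicalSpace C] [ChartedSpace V' C] (j : C → M) : Prop where
  smooth : ContMDiff 𝓘(ℝ, V') 𝓘(ℝ, V) ∞ j
  exists_retraction : ∀ c : C, ∃ O : Set M, IsOpen O ∧ j c ∈ O ∧ ∃ p : M → C,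
    ContMDiffOn 𝓘(ℝ, V) 𝓘(ℝ, V') ∞ p O ∧ ∀ c', j c' ∈ O → p (j c') = c'

theorem hasLocalRetractions_of_isSmoothEmbedding {j : C → M}
    (hj : Manifold.IsSmoothEmbedding 𝓘(ℝ, V') 𝓘(ℝ, V) ∞ j) :
    HasLocalRetractions V V' j := by
  refine ⟨hj.contMDiff, fun c => ?_⟩
  have h := hj.isImmersion.isImmersionAt c
  set φ := h.domChart
  set ψ := h.codChart
  obtain ⟨O₁, hO₁, hO₁φ⟩ := hj.isEmbedding.isOpen_iff.1 φ.open_source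
  let q : M → V' := fun m => (h.equiv.symm (ψ m)).1
  have hψ : ContMDiffOn 𝓘(ℝ, V) 𝓘(ℝ, V) ∞ ψ ψ.source :=
    contMDiffOn_of_mem_maximalAtlas h.codChart_mem_maximalAtlas
  have hL : ContMDiff 𝓘(ℝ, V) 𝓘(ℝ, V') ∞
      ((ContinuousLinearMap.fst ℝ V' h.complement).comp
        (h.equiv.symm : V →L[ℝ] V' × h.complement)) := ContinuousLinearMap.contMDiff _
  have hq : ContMDiffOn 𝓘(ℝ, V) 𝓘(ℝ, V') ∞ q ψ.source := hL.comp_contMDiffOn hψ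
  have hqj : ∀ c' ∈ φ.source, q (j c') = φ c' := by
    intro c' hc'
    have h0 : φ c' ∈ (h.domChart.extend 𝓘(ℝ, V')).target := by
      simpa using! φ.map_source hc'
    have h1 := h.writtenInCharts h0
    have h2 : ψ (j c') = h.equiv (φ c', 0) := by
      simpa [φ.left_inv hc', φ, ψ] using! h1
    simp [q, h2]
  refine ⟨O₁ ∩ (ψ.source ∩ q ⁻¹' φ.target),
    hO₁.inter (hq.continuousOn.isOpen_inter_preimage ψ.open_source φ.open_target), ?_,
    fun m => φ.symm (q m), ?_, ?_⟩
  · have hc : c ∈ φ.source := h.mem_domChart_source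
    refine ⟨by rwa [← hO₁φ] at hc, h.mem_codChart_source, ?_⟩
    rw [mem_preimage, hqj c hc]
    exact φ.map_source hc
  · exact (contMDiffOn_symm_of_mem_maximalAtlas h.domChart_mem_maximalAtlas).comp
      (hq.mono fun m hm => hm.2.1) fun m hm => hm.2.2
  · intro c' hc'
    have h1 : c' ∈ φ.source := by rw [← hO₁φ]; exact hc'.1
    change φ.symm (q (j c')) = c'
    rw [hqj c' h1, φ.left_inv h1]

theorem HasLocalRetractions.comp {V'' : Type*} [NormedAddCommGroup V''] [NormedSpace ℝ V'']
    {B : Type*} [TopologicalSpace B] [ChartedSpace V'' B] {k : B → M} {i : C → B}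
    (hk : HasLocalRetractions V V'' k) (hi : HasLocalRetractions V'' V' i) :
    HasLocalRetractions V V' (k ∘ i) := by
  refine ⟨hk.smooth.comp hi.smooth, fun c => ?_⟩
  obtain ⟨O, hO, hcO, p, hp, hpk⟩ := hk.exists_retraction (i c)
  obtain ⟨O', hO', hcO', p', hp', hpi⟩ := hi.exists_retraction c
  refine ⟨O ∩ p ⁻¹' O', hp.continuousOn.isOpen_inter_preimage hO hO', ⟨hcO, ?_⟩, p' ∘ p,
    hp'.comp (hp.mono inter_subset_left) inter_subset_right, fun c' hc' => ?_⟩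
  · change p (k (i c)) ∈ O'
    rwa [hpk _ hcO]
  · have h1 : p (k (i c')) = i c' := hpk _ hc'.1
    have h2 : i c' ∈ O' := h1 ▸ hc'.2
    simp only [Function.comp_apply, h1, hpi c' h2]

/-- A map with local retractions is a topological embedding, in the form: a property that holds
near `c₀` in `C` holds at all points of `C` whose image is near `j c₀`. -/
theorem HasLocalRetractions.eventually_image {j : C → M} (hj : HasLocalRetractions V V' j)
    {c₀ : C} {Q : C → Prop} (hQ : ∀ᶠ c in 𝓝 c₀, Q c) :
    ∀ᶠ m in 𝓝 (j c₀), ∀ c, j c = m → Q c := by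
  obtain ⟨O, hO, hcO, p, hp, hpj⟩ := hj.exists_retraction c₀
  have h1 : ∀ᶠ m in 𝓝 (j c₀), Q (p m) := by
    refine (hp.continuousOn.continuousAt (hO.mem_nhds hcO)).eventually ?_
    rwa [hpj _ hcO]
  filter_upwards [h1, hO.mem_nhds hcO] with m hm hmO c hc
  subst hc
  rwa [hpj _ hmO] at hm

/-- A function on the target of a surjective submersion is smooth if its pullback is. -/
theorem smoothFun_of_comp_submersion {pr : C → M} (hsurj : Function.Surjective pr)
    (hpr : Manifold.IsSubmersion 𝓘(ℝ, V') 𝓘(ℝ, V) ∞ pr) {g : M → ℝ}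
    (hg : SmoothFun V' fun c => g (pr c)) : SmoothFun V g := by
  intro n
  obtain ⟨c, rfl⟩ := hsurj n
  have h := hpr.isSubmersionAt c
  set φ := h.domChart
  set ψ := h.codChart
  -- in adapted charts `pr` is a linear projection, and `q` is the slice through `c`
  let q : M → V' := fun m => h.equiv.symm (ψ m, (h.equiv (φ c)).2)
  have hψ : ContMDiffOn 𝓘(ℝ, V) 𝓘(ℝ, V) ∞ ψ ψ.source :=
    contMDiffOn_of_mem_maximalAtlas h.codChart_mem_maximalAtlas
  have hL : ContMDiff 𝓘(ℝ, V) 𝓘(ℝ, V') ∞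
      (fun v : V => h.equiv.symm (v, (h.equiv (φ c)).2)) := by
    refine ContDiff.contMDiff ?_
    exact h.equiv.symm.contDiff.comp (contDiff_id.prodMk contDiff_const)
  have hq : ContMDiffOn 𝓘(ℝ, V) 𝓘(ℝ, V') ∞ q ψ.source := hL.comp_contMDiffOn hψ
  have hprc : ∀ c' ∈ φ.source, ψ (pr c') = (h.equiv (φ c')).1 := by
    intro c' hc'
    have h0 : φ c' ∈ (h.domChart.extend 𝓘(ℝ, V')).target := by
      simpa using! φ.map_source hc'
    have h1 := h.writtenInCharts h0
    simpa [φ.left_inv hc', φ, ψ] using! h1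
  have hc : c ∈ φ.source := h.mem_domChart_source
  have hqc : q (pr c) = φ c := by
    simp only [q, hprc c hc, Prod.mk.eta, ContinuousLinearEquiv.symm_apply_apply]
  have hO : IsOpen (ψ.source ∩ q ⁻¹' φ.target) :=
    hq.continuousOn.isOpen_inter_preimage ψ.open_source φ.open_target
  have hcO : pr c ∈ ψ.source ∩ q ⁻¹' φ.target :=
    ⟨h.mem_codChart_source, by rw [mem_preimage, hqc]; exact φ.map_source hc⟩
  have hσ : ContMDiffOn 𝓘(ℝ, V) 𝓘(ℝ, V') ∞ (fun m => φ.symm (q m))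
      (ψ.source ∩ q ⁻¹' φ.target) :=
    (contMDiffOn_symm_of_mem_maximalAtlas h.domChart_mem_maximalAtlas).comp
      (hq.mono inter_subset_left) inter_subset_right
  have hsec : ∀ m ∈ ψ.source ∩ q ⁻¹' φ.target, pr (φ.symm (q m)) = m := by
    intro m hm
    have h1 : φ.symm (q m) ∈ φ.source := φ.map_target hm.2
    refine ψ.injOn (h.source_subset_preimage_source h1) hm.1 ?_
    rw [hprc _ h1, φ.right_inv hm.2]
    simp [q]
  refine ((hg.comp_contMDiffOn hσ).contMDiffAt (hO.mem_nhds hcO)).congr_of_eventuallyEq ?_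
  filter_upwards [hO.mem_nhds hcO] with m hm
  simp [hsec m hm]

end Retraction

section Defining

variable {V : Type*} [NormedAddCommGroup V] [NormedSpace ℝ V] [FiniteDimensional ℝ V]
  {M : Type*} [TopologicalSpace M] [ChartedSpace V M] [IsManifold 𝓘(ℝ, V) ∞ M] [T2Space M]
  {V' : Type*} [NormedAddCommGroup V'] [NormedSpace ℝ V']
  {C : Type*} [TopologicalSpace C] [ChartedSpace V' C]

/-! ### Functions vanishing on a submanifold -/

/-- A submanifold is locally cut out, to first order, by globally smooth functions that vanish on
all of it. They are the components, in a chart of `M`, of the difference between the identity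
and a local retraction. -/
theorem HasLocalRetractions.exists_defining {j : C → M} (hj : HasLocalRetractions V V' j)
    (c₀ : C) : ∃ (n : ℕ) (y : Fin n → M → ℝ), (∀ i, SmoothFun V (y i)) ∧
      (∀ i c, y i (j c) = 0) ∧
      ∀ᶠ c in 𝓝 c₀, ∀ v : TangentSpace 𝓘(ℝ, V) (j c),
        (∀ i, dfun V (y i) (j c) v = 0) → v ∈ tangentImage V V' j c := by
  obtain ⟨O, hO, hcO, p, hp, hpj⟩ := hj.exists_retraction c₀
  let b := Module.finBasis ℝ V
  let e := extChartAt 𝓘(ℝ, V) (j c₀)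
  have he : ContMDiffOn 𝓘(ℝ, V) 𝓘(ℝ, V) ∞ e (chartAt V (j c₀)).source := contMDiffOn_extChartAt
  let x : Fin (Module.finrank ℝ V) → M → ℝ := fun i m => (b.coord i).toContinuousLinearMap (e m)
  have hx : ∀ i, ContMDiffOn 𝓘(ℝ, V) 𝓘(ℝ, ℝ) ∞ (x i) (chartAt V (j c₀)).source := fun i =>
    (ContinuousLinearMap.contMDiff _).comp_contMDiffOn he
  have hjp : ContMDiffOn 𝓘(ℝ, V) 𝓘(ℝ, V) ∞ (j ∘ p) O := hj.smooth.comp_contMDiffOn hp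
  let O' := (chartAt V (j c₀)).source ∩ (O ∩ (j ∘ p) ⁻¹' (chartAt V (j c₀)).source)
  have hO' : IsOpen O' := (chartAt V (j c₀)).open_source.inter
    (hjp.continuousOn.isOpen_inter_preimage hO (chartAt V (j c₀)).open_source)
  have hc₀O' : j c₀ ∈ O' := by
    refine ⟨mem_chart_source V _, hcO, ?_⟩
    change j (p (j c₀)) ∈ (chartAt V (j c₀)).source
    rw [hpj _ hcO]
    exact mem_chart_source V _
  let u : Fin (Module.finrank ℝ V) → M → ℝ := fun i m => x i m - x i (j (p m))
  have hu : ∀ i, ContMDiffOn 𝓘(ℝ, V) 𝓘(ℝ, ℝ) ∞ (u i) O' := fun i =>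
    ((hx i).mono inter_subset_left).sub
      (ContMDiffOn.comp (g := x i) (f := j ∘ p) (hx i)
        (hjp.mono (inter_subset_right.trans inter_subset_left))
        (inter_subset_right.trans inter_subset_right))
  choose y hy hyu hy0 using fun i => exists_smoothFun_eventuallyEq hO' hc₀O' (hu i)
  refine ⟨_, y, hy, fun i c => hy0 i _ fun hc => ?_, ?_⟩
  · simp only [u, hpj c hc.2.1, sub_self]
  have hev : ∀ᶠ m in 𝓝 (j c₀), m ∈ O' ∧ ∀ i, y i =ᶠ[𝓝 m] u i :=
    Filter.Eventually.and (hO'.mem_nhds hc₀O') (eventually_all.2 fun i => (hyu i).eventually_nhds)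
  filter_upwards [hj.smooth.continuous.continuousAt.eventually hev] with c hc v hv
  obtain ⟨hcO', hyuc⟩ := hc
  -- a vector `v` with `dx v = d(x ∘ j ∘ p) v` is the image of `w = dp v`
  have hpc : p (j c) = c := hpj c hcO'.2.1
  have hxd : MDifferentiableAt 𝓘(ℝ, V) 𝓘(ℝ, V) e (j c) :=
    mdifferentiableAt_extChartAt hcO'.1
  have hxid : ∀ i, MDifferentiableAt 𝓘(ℝ, V) 𝓘(ℝ, ℝ) (x i) (j c) := fun i =>
    ((hx i _ hcO'.1).contMDiffAt ((chartAt V (j c₀)).open_source.mem_nhds hcO'.1)).mdifferentiableAt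
      (by simp)
  have hjd : MDifferentiableAt 𝓘(ℝ, V') 𝓘(ℝ, V) j c := hj.smooth.mdifferentiableAt (by simp)
  have hpd : MDifferentiableAt 𝓘(ℝ, V) 𝓘(ℝ, V') p (j c) :=
    ((hp _ hcO'.2.1).contMDiffAt (hO.mem_nhds hcO'.2.1)).mdifferentiableAt (by simp)
  have hxjd : ∀ i, MDifferentiableAt 𝓘(ℝ, V') 𝓘(ℝ, ℝ) (fun c => x i (j c)) c := fun i =>
    (hxid i).comp c hjd
  let w : V' := mfderiv 𝓘(ℝ, V) 𝓘(ℝ, V') p (j c) v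
  refine ⟨w, ?_⟩
  have hdx : ∀ i (v' : TangentSpace 𝓘(ℝ, V) (j c)),
      dfun V (x i) (j c) v' = b.coord i (mfderiv 𝓘(ℝ, V) 𝓘(ℝ, V) e (j c) v') := by
    intro i v'
    refine (dfun_comp (f := ((b.coord i).toContinuousLinearMap : V → ℝ))
      ((ContinuousLinearMap.differentiableAt _).mdifferentiableAt) hxd v').trans ?_
    refine (dfun_eq_fderiv _ _ _).trans ?_
    rw [ContinuousLinearMap.fderiv]
    rfl
  have hdxjp : ∀ i, MDifferentiableAt 𝓘(ℝ, V) 𝓘(ℝ, ℝ) (fun m => x i (j (p m))) (j c) ∧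
      dfun V (fun m => x i (j (p m))) (j c) v =
        dfun V (x i) (j c) (mfderiv 𝓘(ℝ, V') 𝓘(ℝ, V) j c w) := by
    intro i
    have h1 : ∀ c', c' = c → MDifferentiableAt 𝓘(ℝ, V') 𝓘(ℝ, ℝ) (fun c => x i (j c)) c' ∧
        dfun V' (fun c => x i (j c)) c' w = dfun V' (fun c => x i (j c)) c w := by
      rintro c' rfl
      exact ⟨hxjd i, rfl⟩
    obtain ⟨h2, h3⟩ := h1 _ hpc
    refine ⟨h2.comp (j c) hpd, ?_⟩
    exact ((dfun_comp (f := fun c => x i (j c)) h2 hpd v).trans h3).trans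
      (dfun_comp (hxid i) hjd w)
  have hinj : Function.Injective (mfderiv 𝓘(ℝ, V) 𝓘(ℝ, V) e (j c)) :=
    (isInvertible_mfderiv_extChartAt
      (by rw [extChartAt_source]; exact hcO'.1)).injective
  refine hinj (b.ext_elem fun i => ?_)
  have h1 := hv i
  rw [dfun_congr (hyuc i), dfun_sub (hxid i) (hdxjp i).1, LinearMap.sub_apply, (hdxjp i).2,
    sub_eq_zero, hdx, hdx] at h1
  exact h1.symm

/-- A covector that annihilates `TC` is the differential of a smooth function vanishing on `C`. -/
theorem HasLocalRetractions.exists_vanishing {j : C → M} (hj : HasLocalRetractions V V' j)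
    (c : C) (ξ : Cotangent V (j c)) (hξ : ∀ v ∈ tangentImage V V' j c, ξ v = 0) :
    ∃ u : M → ℝ, SmoothFun V u ∧ (∀ c', u (j c') = 0) ∧ dfun V u (j c) = ξ := by
  obtain ⟨n, y, hy, hy0, hker⟩ := hj.exists_defining c
  have hmem : ξ ∈ Submodule.span ℝ (range fun i => dfun V (y i) (j c)) := by
    refine mem_span_of_iInf_ker_le_ker fun v hv => ?_
    refine hξ v (hker.self_of_nhds v fun i => ?_)
    exact (Submodule.mem_iInf _).1 hv i
  obtain ⟨a, ha⟩ := (Submodule.mem_span_range_iff_exists_fun ℝ).1 hmem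
  have hd : ∀ i ∈ Finset.univ, MDifferentiableAt 𝓘(ℝ, V) 𝓘(ℝ, ℝ) (fun m => a i * y i m) (j c) :=
    fun i _ => mdifferentiableAt_const.mul ((hy i).mdifferentiableAt _)
  refine ⟨fun m => ∑ i, a i * y i m, ?_, fun c' => by simp [hy0], ?_⟩
  · exact SmoothFun.sum _ fun i => (SmoothFun.const _).mul (hy i)
  · rw [(dfun_sum _ hd).2, ← ha]
    refine Finset.sum_congr rfl fun i _ => ?_
    rw [dfun_mul mdifferentiableAt_const ((hy i).mdifferentiableAt _), dfun_const, smul_zero,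
      add_zero]

end Defining

/-! ### Linear systems of locally constant rank -/

/-- Near a linearly independent family `w₀`, functionals with prescribed values `b k` on the
vectors `w k` can be chosen to depend smoothly on `w` and `b`. With `P` a left inverse of
`x ↦ ∑ k, x k • w₀ k`, the functional is `b ∘ (P ∘ w)⁻¹ ∘ P`. -/
theorem exists_smooth_functional {κ : Type*} [Fintype κ] {n : ℕ} (w₀ : κ → Fin n → ℝ)
    (h : LinearIndependent ℝ w₀) :
    ∃ (Ω : Set (κ → Fin n → ℝ)) (Θ : (κ → Fin n → ℝ) × (κ → ℝ) → Fin n → ℝ),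
      IsOpen Ω ∧ w₀ ∈ Ω ∧ ContDiffOn ℝ ∞ Θ (Ω ×ˢ univ) ∧
      ∀ w ∈ Ω, ∀ b k, ∑ i, Θ (w, b) i * w k i = b k := by
  classical
  obtain ⟨P, hP⟩ := LinearMap.exists_leftInverse_of_injective (Fintype.linearCombination ℝ w₀)
    (LinearMap.ker_eq_bot.2 h.fintypeLinearCombination_injective)
  let G : (κ → Fin n → ℝ) →L[ℝ] ((κ → ℝ) →L[ℝ] (κ → ℝ)) := LinearMap.toContinuousLinearMap
    { toFun := fun w => LinearMap.toContinuousLinearMap (P ∘ₗ Fintype.linearCombination ℝ w)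
      map_add' := fun w w' => by
        ext x : 1
        simp [Fintype.linearCombination_apply, Finset.sum_add_distrib]
      map_smul' := fun a w => by
        ext x : 1
        simp [Fintype.linearCombination_apply, Finset.smul_sum, smul_comm a] }
  have hG : ∀ w x, G w x = P (Fintype.linearCombination ℝ w x) := fun w x => rfl
  have hG₀ : G w₀ = 1 := by
    ext x : 1
    rw [hG]
    exact LinearMap.congr_fun hP x
  let Ω : Set (κ → Fin n → ℝ) := {w | IsUnit (G w)}
  let Θ : (κ → Fin n → ℝ) × (κ → ℝ) → Fin n → ℝ := fun q i =>
    ∑ k, q.2 k * Ring.inverse (G q.1) (P (Pi.single i 1)) k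
  refine ⟨Ω, Θ, Units.isOpen.preimage G.continuous, by simp [Ω, hG₀], ?_, ?_⟩
  · refine contDiffOn_pi.2 fun i => ContDiffOn.sum fun k _ => ?_
    rintro ⟨w, b⟩ ⟨hw, -⟩
    have h1 : ContDiffAt ℝ ∞
        (fun q : (κ → Fin n → ℝ) × (κ → ℝ) => Ring.inverse (G q.1)) (w, b) := by
      obtain ⟨g, hg⟩ := hw
      have h2 : ContDiffAt ℝ ∞ Ring.inverse (G w) := hg ▸ contDiffAt_ringInverse ℝ g
      exact h2.comp (w, b) (G.contDiff.contDiffAt.comp _ contDiffAt_fst)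
    have h3 : ContDiffAt ℝ ∞ (fun q : (κ → Fin n → ℝ) × (κ → ℝ) =>
        Ring.inverse (G q.1) (P (Pi.single i 1)) k) (w, b) :=
      contDiffAt_pi.1 (h1.clm_apply contDiffAt_const) k
    have h4 : ContDiffAt ℝ ∞ (fun q : (κ → Fin n → ℝ) × (κ → ℝ) => q.2 k) (w, b) :=
      contDiffAt_pi.1 contDiffAt_snd k
    exact (h4.mul h3).contDiffWithinAt
  · intro w hw b k
    have h1 : ∀ v : Fin n → ℝ, ∑ i, Θ (w, b) i * v i = ∑ l, b l * Ring.inverse (G w) (P v) l := by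
      intro v
      have h2 : P v = ∑ i, v i • P (Pi.single i 1) := by
        conv_lhs => rw [pi_eq_sum_univ' v]
        simp [map_sum]
      simp only [Θ, h2, map_sum, map_smul, Finset.sum_apply, Pi.smul_apply, smul_eq_mul,
        Finset.sum_mul, Finset.mul_sum]
      rw [Finset.sum_comm]
      exact Finset.sum_congr rfl fun _ _ => Finset.sum_congr rfl fun _ _ => by ring
    have h2 : P (w k) = G w (Pi.single k 1) := by
      rw [hG, Fintype.linearCombination_apply_single, one_smul]
    have h3 : Ring.inverse (G w) (P (w k)) = Pi.single k 1 := by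
      rw [h2]
      exact DFunLike.congr_fun (Ring.inverse_mul_cancel (G w) hw) _
    rw [h1, h3]
    simp [Pi.single_apply]

section System

variable {V' : Type*} [NormedAddCommGroup V'] [NormedSpace ℝ V']
  {C : Type*} [TopologicalSpace C] [ChartedSpace V' C]

/-- A smooth family of consistent linear systems of locally constant rank has a smooth family of
solutions near every point. -/
theorem exists_smooth_solution {r n : ℕ} {U : Set C} (hU : IsOpen U) {c₀ : C} (hc₀ : c₀ ∈ U)
    {W : Fin r → C → Fin n → ℝ} {β : Fin r → C → ℝ}
    (hW : ∀ a, ContMDiffOn 𝓘(ℝ, V') 𝓘(ℝ, Fin n → ℝ) ∞ (W a) U)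
    (hβ : ∀ a, ContMDiffOn 𝓘(ℝ, V') 𝓘(ℝ, ℝ) ∞ (β a) U)
    (hrank : ∀ c ∈ U, Module.finrank ℝ (Submodule.span ℝ (range fun a => W a c)) =
      Module.finrank ℝ (Submodule.span ℝ (range fun a => W a c₀)))
    (hcompat : ∀ c ∈ U, ∀ x : Fin r → ℝ, ∑ a, x a • W a c = 0 → ∑ a, x a * β a c = 0) :
    ∃ (U' : Set C) (θ : C → Fin n → ℝ), IsOpen U' ∧ c₀ ∈ U' ∧ U' ⊆ U ∧
      ContMDiffOn 𝓘(ℝ, V') 𝓘(ℝ, Fin n → ℝ) ∞ θ U' ∧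
      ∀ c ∈ U', ∀ a, ∑ i, θ c i * W a c i = β a c := by
  classical
  obtain ⟨κ, g, hg, hspan, hli⟩ := exists_linearIndependent' ℝ (fun a => W a c₀)
  have : Finite κ := Finite.of_injective g hg
  have := Fintype.ofFinite κ
  obtain ⟨Ω, Θ, hΩ, hw₀, hΘ, hsol⟩ := exists_smooth_functional _ hli
  let w : C → κ → Fin n → ℝ := fun c k => W (g k) c
  let b : C → κ → ℝ := fun c k => β (g k) c
  have hw : ContMDiffOn 𝓘(ℝ, V') 𝓘(ℝ, κ → Fin n → ℝ) ∞ w U :=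
    contMDiffOn_pi_space.2 fun k => hW (g k)
  have hb : ContMDiffOn 𝓘(ℝ, V') 𝓘(ℝ, κ → ℝ) ∞ b U := contMDiffOn_pi_space.2 fun k => hβ (g k)
  refine ⟨U ∩ w ⁻¹' Ω, fun c => Θ (w c, b c), hw.continuousOn.isOpen_inter_preimage hU hΩ,
    ⟨hc₀, hw₀⟩, inter_subset_left, ?_, ?_⟩
  · have hwb : ContMDiffOn 𝓘(ℝ, V') 𝓘(ℝ, (κ → Fin n → ℝ) × (κ → ℝ)) ∞ (fun c => (w c, b c)) U :=
      hw.prodMk_space hb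
    exact hΘ.contMDiffOn.comp (hwb.mono inter_subset_left) fun c hc => ⟨hc.2, mem_univ _⟩
  · rintro c ⟨hcU, hcΩ⟩ a
    -- the vectors `w c k` are independent since functionals separate them, and by the rank
    -- condition they span
    have hlic : LinearIndependent ℝ (w c) := by
      rw [Fintype.linearIndependent_iff]
      intro x hx k
      have h1 := hsol (w c) hcΩ (Pi.single k 1)
      have h2 : ∑ l, x l * ∑ i, Θ (w c, Pi.single k 1) i * w c l i = 0 := by
        have h3 : ∀ i, ∑ l, x l * w c l i = 0 := fun i => by
          simpa using congrFun hx i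
        simp only [Finset.mul_sum]
        rw [Finset.sum_comm]
        refine Finset.sum_eq_zero fun i _ => ?_
        rw [← mul_zero (Θ (w c, Pi.single k 1) i), ← h3 i, Finset.mul_sum]
        exact Finset.sum_congr rfl fun _ _ => by ring
      simpa [h1, Pi.single_apply] using h2
    have hle : Submodule.span ℝ (range (w c)) ≤ Submodule.span ℝ (range fun a => W a c) :=
      Submodule.span_mono (by rintro _ ⟨k, rfl⟩; exact ⟨g k, rfl⟩)
    have heq : Submodule.span ℝ (range (w c)) = Submodule.span ℝ (range fun a => W a c) := by
      refine Submodule.eq_of_le_of_finrank_eq hle ?_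
      rw [hrank c hcU, ← hspan, finrank_span_eq_card hlic]
      exact (finrank_span_eq_card hli).symm
    have hmem : W a c ∈ Submodule.span ℝ (range (w c)) :=
      heq ▸ Submodule.subset_span ⟨a, rfl⟩
    obtain ⟨x, hx⟩ := (Submodule.mem_span_range_iff_exists_fun ℝ).1 hmem
    have hβa : β a c = ∑ k, x k * b c k := by
      have h1 := hcompat c hcU (fun a' => (Pi.single a 1 : Fin r → ℝ) a' -
        ∑ k, if g k = a' then x k else 0)
      simp only [sub_smul, sub_mul, Finset.sum_sub_distrib, Finset.sum_smul, Finset.sum_mul,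
        Pi.single_apply, ite_smul, ite_mul, one_smul, zero_smul, one_mul, zero_mul,
        Finset.sum_ite_eq', Finset.mem_univ, if_true] at h1
      rw [Finset.sum_comm, Finset.sum_comm (f := fun a' k => if g k = a' then x k * β a' c else 0)]
        at h1
      simp only [Finset.sum_ite_eq, Finset.mem_univ, if_true] at h1
      exact sub_eq_zero.1 (h1 (sub_eq_zero.2 hx.symm))
    rw [hβa, ← hx]
    simp only [Finset.sum_apply, Pi.smul_apply, smul_eq_mul, Finset.mul_sum]
    rw [Finset.sum_comm]
    refine Finset.sum_congr rfl fun k _ => ?_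
    rw [← hsol (w c) hcΩ (b c) k, Finset.mul_sum]
    exact Finset.sum_congr rfl fun _ _ => by ring

end System

section Lift

variable {V : Type*} [NormedAddCommGroup V] [NormedSpace ℝ V] [FiniteDimensional ℝ V]
  {M : Type*} [TopologicalSpace M] [ChartedSpace V M] [IsManifold 𝓘(ℝ, V) ∞ M] [T2Space M]
  {V' : Type*} [NormedAddCommGroup V'] [NormedSpace ℝ V']
  {C : Type*} [TopologicalSpace C] [ChartedSpace V' C]

/-! ### Lifting functions to adapted functions -/

/-- Local existence of lifts: the differential of an extension of `g` is corrected by a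
combination `∑ i, θ i * y i` of functions vanishing on `C`, where the coefficients `θ` solve a
linear system whose rank `rank E - rank (E ∩ TC)` is locally constant. -/
theorem exists_local_lift {j : C → M} (hj : HasLocalRetractions V V' j)
    {E : ∀ c : C, Submodule ℝ (TangentSpace 𝓘(ℝ, V) (j c))} (hE : IsSmoothSubbundle V' j E)
    (hrank : IsLocallyConstant fun c => Module.finrank ℝ ↥(E c ⊓ tangentImage V V' j c))
    {g : C → ℝ} (hg : SmoothFun V' g)
    (hgE : ∀ c v, mfderiv 𝓘(ℝ, V') 𝓘(ℝ, V) j c v ∈ E c → dfun V' g c v = 0) (c₀ : C) :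
    ∃ f : M → ℝ, SmoothFun V f ∧
      ∀ᶠ c in 𝓝 c₀, f (j c) = g c ∧ dfun V f (j c) ∈ (E c).dualAnnihilator := by
  obtain ⟨O, hO, hcO, p, hp, hpj⟩ := hj.exists_retraction c₀
  obtain ⟨F, hF, hFg, -⟩ := exists_smoothFun_eventuallyEq hO hcO
    (ContMDiff.comp_contMDiffOn hg hp)
  obtain ⟨n, y, hy, hy0, hker⟩ := hj.exists_defining c₀
  obtain ⟨U₀, hU₀, hc₀U₀, r, s, hs, hsE⟩ := hE c₀
  have hFj : ∀ᶠ c in 𝓝 c₀, F (j c) = g c := by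
    filter_upwards [hj.smooth.continuous.continuousAt.eventually (hFg.and (hO.mem_nhds hcO))]
      with c hc
    rw [hc.1]
    exact congrArg g (hpj c hc.2)
  have hrank' := (hrank.eventually_eq c₀)
  obtain ⟨U, hUsub, hU, hc₀U⟩ := mem_nhds_iff.1
    (Filter.inter_mem (hU₀.mem_nhds hc₀U₀) (hker.and (hFj.eventually_nhds.and hrank')))
  have hjd : ∀ c, MDifferentiableAt 𝓘(ℝ, V') 𝓘(ℝ, V) j c := fun c =>
    hj.smooth.mdifferentiableAt (by simp)
  have hFd : ∀ c ∈ U, ∀ v ∈ E c ⊓ tangentImage V V' j c, dfun V F (j c) v = 0 := by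
    rintro c hc _ ⟨hvE, u, rfl⟩
    refine (dfun_comp (hF.mdifferentiableAt _) (hjd c) u).symm.trans ?_
    rw [dfun_congr (hUsub hc).2.2.1]
    exact hgE c u hvE
  have hyT : ∀ c i, ∀ v ∈ tangentImage V V' j c, dfun V (y i) (j c) v = 0 := by
    rintro c i _ ⟨u, rfl⟩
    refine (dfun_comp ((hy i).mdifferentiableAt _) (hjd c) u).symm.trans ?_
    simp only [hy0, dfun_const, LinearMap.zero_apply]
  -- `Y c` has kernel `T_c C`, so `θ` must solve `∑ i, θ i * Y c v i = dF v` for `v ∈ E c`; on a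
  -- frame of `E` this is a linear system whose rank is the dimension of `Y c (E c)`
  let Y : ∀ c, TangentSpace 𝓘(ℝ, V) (j c) →ₗ[ℝ] (Fin n → ℝ) := fun c =>
    LinearMap.pi fun i => dfun V (y i) (j c)
  let W : Fin r → C → Fin n → ℝ := fun a c => Y c (s a c)
  let β : Fin r → C → ℝ := fun a c => dfun V F (j c) (s a c)
  have hUU₀ : U ⊆ U₀ := fun c hc => (hUsub hc).1
  have hinf : ∀ c ∈ U, E c ⊓ LinearMap.ker (Y c) = E c ⊓ tangentImage V V' j c := by
    intro c hc
    ext v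
    refine and_congr_right fun _ => ⟨fun hv => (hUsub hc).2.1 v fun i => congrFun hv i,
      fun hv => ?_⟩
    exact funext fun i => hyT c i v hv
  have hspan : ∀ c ∈ U, Submodule.span ℝ (range fun a => W a c) = (E c).map (Y c) := by
    intro c hc
    rw [← (hsE c (hUU₀ hc)).2, Submodule.map_span, ← range_comp]
    rfl
  have hfr : ∀ c ∈ U, Module.finrank ℝ (Submodule.span ℝ (range fun a => W a c)) +
      Module.finrank ℝ ↥(E c ⊓ tangentImage V V' j c) = r := by
    intro c hc
    have h1 := LinearMap.finrank_range_add_finrank_ker ((Y c).domRestrict (E c))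
    have h2 : LinearMap.range ((Y c).domRestrict (E c)) = (E c).map (Y c) := by
      rw [LinearMap.range_domRestrict]
    have h3 : Module.finrank ℝ (E c) = r := by
      rw [← (hsE c (hUU₀ hc)).2, finrank_span_eq_card (hsE c (hUU₀ hc)).1, Fintype.card_fin]
    have h4 : Module.finrank ℝ (LinearMap.ker ((Y c).domRestrict (E c))) =
        Module.finrank ℝ ↥(E c ⊓ LinearMap.ker (Y c)) := by
      rw [LinearMap.ker_domRestrict, ← Submodule.map_comap_subtype]
      exact (Submodule.finrank_map_subtype_eq _ _).symm
    rw [hspan c hc, ← hinf c hc, ← h4, ← h2, h1, h3]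
  obtain ⟨U', θ, hU', hc₀U', hU'U, hθ, hθsol⟩ := exists_smooth_solution (V' := V') hU hc₀U
    (W := W) (β := β)
    (fun a => contMDiffOn_pi_space.2 fun i => contMDiffOn_dfun_section (hy i) ((hs a).mono hUU₀))
    (fun a => contMDiffOn_dfun_section hF ((hs a).mono hUU₀))
    (fun c hc => by
      have h1 := hfr c hc
      have h2 := hfr c₀ hc₀U
      have h3 : Module.finrank ℝ ↥(E c ⊓ tangentImage V V' j c) =
        Module.finrank ℝ ↥(E c₀ ⊓ tangentImage V V' j c₀) := (hUsub hc).2.2.2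
      omega)
    (fun c hc x hx => by
      have h1 : ∑ a, x a • s a c ∈ E c := Submodule.sum_mem _ fun a _ =>
        Submodule.smul_mem _ _ ((hsE c (hUU₀ hc)).2 ▸ Submodule.subset_span ⟨a, rfl⟩)
      have h2 : Y c (∑ a, x a • s a c) = 0 := by
        rw [map_sum, ← hx]
        exact Finset.sum_congr rfl fun a _ => map_smul _ _ _
      have h3 := hFd c hc (∑ a, x a • s a c) (hinf c hc ▸ ⟨h1, h2⟩)
      rw [map_sum] at h3
      rw [← h3]
      exact Finset.sum_congr rfl fun a _ => (map_smul (dfun V F (j c)) (x a) (s a c)).symm)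
  have hOU' : IsOpen (O ∩ p ⁻¹' U') := hp.continuousOn.isOpen_inter_preimage hO hU'
  have hcOU' : j c₀ ∈ O ∩ p ⁻¹' U' := ⟨hcO, by rwa [mem_preimage, hpj _ hcO]⟩
  have hθp : ∀ i, ContMDiffOn 𝓘(ℝ, V) 𝓘(ℝ, ℝ) ∞ (fun m => θ (p m) i) (O ∩ p ⁻¹' U') := fun i =>
    ContMDiffOn.comp (g := fun c => θ c i) (contMDiffOn_pi_space.1 hθ i)
      (hp.mono inter_subset_left) inter_subset_right
  choose t ht htθ _ using fun i => exists_smoothFun_eventuallyEq hOU' hcOU' (hθp i)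
  refine ⟨fun m => F m - ∑ i, t i m * y i m,
    hF.sub (SmoothFun.sum _ fun i => (ht i).mul (hy i)), ?_⟩
  have hev : ∀ᶠ m in 𝓝 (j c₀), m ∈ O ∩ p ⁻¹' U' ∧ ∀ i, t i m = θ (p m) i :=
    Filter.Eventually.and (hOU'.mem_nhds hcOU') (eventually_all.2 htθ)
  filter_upwards [hj.smooth.continuous.continuousAt.eventually hev] with c hc
  obtain ⟨⟨hcO', hcU'⟩, htc⟩ := hc
  have hpc : p (j c) = c := hpj c hcO'
  rw [mem_preimage, hpc] at hcU'
  rw [hpc] at htc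
  refine ⟨?_, ?_⟩
  · simp [hy0, (hUsub (hU'U hcU')).2.2.1.self_of_nhds]
  · have hd : ∀ i ∈ Finset.univ,
        MDifferentiableAt 𝓘(ℝ, V) 𝓘(ℝ, ℝ) (fun m => t i m * y i m) (j c) :=
      fun i _ => ((ht i).mul (hy i)).mdifferentiableAt _
    have hdf : ∀ v, dfun V (fun m => F m - ∑ i, t i m * y i m) (j c) v =
        dfun V F (j c) v - ∑ i, θ c i * dfun V (y i) (j c) v := by
      intro v
      rw [dfun_sub (hF.mdifferentiableAt _) (dfun_sum _ hd).1, (dfun_sum _ hd).2,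
        LinearMap.sub_apply, LinearMap.sum_apply]
      congr 1
      refine Finset.sum_congr rfl fun i _ => ?_
      rw [dfun_mul ((ht i).mdifferentiableAt _) ((hy i).mdifferentiableAt _), hy0, htc]
      simp
    rw [Submodule.mem_dualAnnihilator, ← (hsE c (hUU₀ (hU'U hcU'))).2]
    intro v hv
    refine LinearMap.mem_ker.1 ((Submodule.span_le.2 ?_ :
      _ ≤ LinearMap.ker (dfun V (fun m => F m - ∑ i, t i m * y i m) (j c))) hv)
    rintro _ ⟨a, rfl⟩
    refine LinearMap.mem_ker.2 ?_
    rw [hdf]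
    exact sub_eq_zero.2 (hθsol c hcU' a).symm

/-- If `g` is a function on `C` whose differential annihilates `E ∩ TC`, then `g` extends to a
smooth function on `M` whose differential annihilates `E`. The local solutions are glued by a
partition of unity; its derivatives do not contribute since the local solutions agree on `C`. -/
theorem exists_adaptedFun_lift [SecondCountableTopology M] {j : C → M}
    (hj : HasLocalRetractions V V' j) (hclosed : IsClosed (range j))
    {E : ∀ c : C, Submodule ℝ (TangentSpace 𝓘(ℝ, V) (j c))} (hE : IsSmoothSubbundle V' j E)
    (hrank : IsLocallyConstant fun c => Module.finrank ℝ ↥(E c ⊓ tangentImage V V' j c))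
    {g : C → ℝ} (hg : SmoothFun V' g)
    (hgE : ∀ c v, mfderiv 𝓘(ℝ, V') 𝓘(ℝ, V) j c v ∈ E c → dfun V' g c v = 0) :
    ∃ f ∈ AdaptedFun j E, ∀ c, f (j c) = g c := by
  have hloc : ∀ m : M, ∃ (f : M → ℝ) (O : Set M), SmoothFun V f ∧ IsOpen O ∧ m ∈ O ∧
      ∀ c, j c ∈ O → f (j c) = g c ∧ dfun V f (j c) ∈ (E c).dualAnnihilator := by
    intro m
    by_cases hm : m ∈ range j
    · obtain ⟨c₀, rfl⟩ := hm
      obtain ⟨f, hf, hfc⟩ := exists_local_lift hj hE hrank hg hgE c₀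
      obtain ⟨O, hO, hO', hmO⟩ := mem_nhds_iff.1 (hj.eventually_image hfc)
      exact ⟨f, O, hf, hO', hmO, fun c hc => hO hc c rfl⟩
    · exact ⟨fun _ => 0, (range j)ᶜ, SmoothFun.const 0, hclosed.isOpen_compl, hm,
        fun c hc => absurd (mem_range_self c) hc⟩
  choose f O hf hO hmO hfO using hloc
  have : LocallyCompactSpace M := Manifold.locallyCompact_of_finiteDimensional 𝓘(ℝ, V)
  obtain ⟨ρ, hρ⟩ := SmoothPartitionOfUnity.exists_isSubordinate 𝓘(ℝ, V) (isClosed_univ (X := M)) O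
    hO fun m _ => mem_iUnion.2 ⟨m, hmO m⟩
  have hρs : ∀ i, SmoothFun V (ρ i) := fun i => (ρ i).contMDiff
  let h : M → ℝ := fun m => ∑ᶠ i, ρ i m • f i m
  have hh : SmoothFun V h := ρ.contMDiff_finsum_smul fun i x _ => hf i x
  have hkey : ∀ c, h =ᶠ[𝓝 (j c)] fun m =>
      (∑ i ∈ ρ.fintsupport (j c), ρ i m * (f i m - g c)) + g c := by
    intro c
    filter_upwards [ρ.eventually_finsupport_subset (j c)] with m hm
    have h1 : ∑ i ∈ ρ.fintsupport (j c), ρ i m = 1 := ρ.sum_finsupport' m (mem_univ m) hm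
    have h2 : h m = ∑ i ∈ ρ.fintsupport (j c), ρ i m * f i m := by
      refine finsum_eq_sum_of_support_subset _ fun i hi => hm ?_
      rw [ρ.mem_finsupport]
      exact fun h0 => hi (by simp [h0])
    rw [h2]
    simp only [mul_sub, Finset.sum_sub_distrib, ← Finset.sum_mul, h1, one_mul, sub_add_cancel]
  have hgood : ∀ c, ∀ i ∈ ρ.fintsupport (j c),
      f i (j c) = g c ∧ dfun V (f i) (j c) ∈ (E c).dualAnnihilator := fun c i hi =>
    hfO i c (hρ i ((ρ.mem_fintsupport_iff _ i).1 hi))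
  refine ⟨h, ⟨hh, fun c => ?_⟩, fun c => ?_⟩
  · have hs : ∀ i, SmoothFun V fun m => f i m - g c := fun i => (hf i).sub (SmoothFun.const _)
    have hd : ∀ i ∈ ρ.fintsupport (j c),
        MDifferentiableAt 𝓘(ℝ, V) 𝓘(ℝ, ℝ) (fun m => ρ i m * (f i m - g c)) (j c) := fun i _ =>
      ((hρs i).mul (hs i)).mdifferentiableAt _
    rw [dfun_congr (hkey c), dfun_add (dfun_sum _ hd).1 mdifferentiableAt_const, dfun_const,
      add_zero, (dfun_sum _ hd).2]
    refine Submodule.sum_mem _ fun i hi => ?_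
    obtain ⟨h1, h2⟩ := hgood c i hi
    rw [dfun_mul ((hρs i).mdifferentiableAt _) ((hs i).mdifferentiableAt _), h1, sub_self,
      zero_smul, add_zero, dfun_sub ((hf i).mdifferentiableAt _) mdifferentiableAt_const,
      dfun_const, sub_zero]
    exact Submodule.smul_mem _ _ h2
  · have h0 : ∑ i ∈ ρ.fintsupport (j c), ρ i (j c) * (f i (j c) - g c) = 0 :=
      Finset.sum_eq_zero fun i hi => by rw [(hgood c i hi).1, sub_self, mul_zero]
    refine (hkey c).self_of_nhds.trans ?_
    simp only [h0, zero_add]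

end Lift

section Bracket

variable {V : Type*} [NormedAddCommGroup V] [NormedSpace ℝ V]
  {M : Type*} [TopologicalSpace M] [ChartedSpace V M]
  {V' : Type*} [NormedAddCommGroup V'] [NormedSpace ℝ V']
  {C : Type*} [TopologicalSpace C] [ChartedSpace V' C]

/-! ### The bracket along the submanifold -/

/-- Bivectors in `E ∧ TM` vanish on `E° × E°`. -/
theorem wedgeTangent_apply_eq_zero {p : M} {E : Submodule ℝ (TangentSpace 𝓘(ℝ, V) p)}
    {Λ : Contra2 V p} (hΛ : Λ ∈ wedgeTangent E) {ξ η : Cotangent V p}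
    (hξ : ξ ∈ E.dualAnnihilator) (hη : η ∈ E.dualAnnihilator) : Λ ξ η = 0 := by
  induction hΛ using Submodule.span_induction with
  | mem w hw =>
    obtain ⟨u, hu, v, rfl⟩ := hw
    have h1 : ξ u = 0 := (Submodule.mem_dualAnnihilator _).1 hξ u hu
    have h2 : η u = 0 := (Submodule.mem_dualAnnihilator _).1 hη u hu
    simp [wedge, h1, h2]
  | zero => rfl
  | add w w' _ _ h h' => rw [LinearMap.add_apply, LinearMap.add_apply, h, h', add_zero]
  | smul a w _ h => rw [LinearMap.smul_apply, LinearMap.smul_apply, h, smul_zero]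

theorem dfun_apply_tangentImage {j : C → M} (hj : ContMDiff 𝓘(ℝ, V') 𝓘(ℝ, V) ∞ j) {f f' : M → ℝ}
    (hf : SmoothFun V f) (hf' : SmoothFun V f') (hff' : ∀ c, f (j c) = f' (j c)) {c : C}
    {v : TangentSpace 𝓘(ℝ, V) (j c)} (hv : v ∈ tangentImage V V' j c) :
    dfun V f (j c) v = dfun V f' (j c) v := by
  obtain ⟨u, rfl⟩ := hv
  have hjc : MDifferentiableAt 𝓘(ℝ, V') 𝓘(ℝ, V) j c := hj.mdifferentiableAt (by simp)
  have h := dfun_comp (hf.mdifferentiableAt _) hjc u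
  simp only [hff'] at h
  exact h.symm.trans (dfun_comp (hf'.mdifferentiableAt _) hjc u)

theorem dfun_apply_tangentImage_eq_zero {j : C → M} (hj : ContMDiff 𝓘(ℝ, V') 𝓘(ℝ, V) ∞ j)
    {f : M → ℝ} (hf : SmoothFun V f) (hfj : ∀ c, f (j c) = 0) {c : C}
    {v : TangentSpace 𝓘(ℝ, V) (j c)} (hv : v ∈ tangentImage V V' j c) :
    dfun V f (j c) v = 0 := by
  rw [dfun_apply_tangentImage hj hf (SmoothFun.const 0) hfj hv, dfun_const, LinearMap.zero_apply]

/-- Functions whose differential annihilates `E ∩ TC` are constant on the leaves. -/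
theorem AdaptedFun.eq_of_sameLeaf {j : C → M} (hj : ContMDiff 𝓘(ℝ, V') 𝓘(ℝ, V) ∞ j)
    {E : ∀ c : C, Submodule ℝ (TangentSpace 𝓘(ℝ, V) (j c))} {h : M → ℝ}
    (hh : h ∈ AdaptedFun j fun c => E c ⊓ tangentImage V V' j c) {x y : C}
    (hxy : SameLeaf (intersectTangent V' j E) x y) : h (j x) = h (j y) := by
  induction hxy with
  | rel x y hxy =>
    obtain ⟨γ, hγ, rfl, rfl, hγF⟩ := hxy
    have hhj : SmoothFun V' fun c => h (j c) := ContMDiff.comp hh.1 hj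
    have hder : ∀ t, HasDerivAt (fun s => h (j (γ s))) 0 t := by
      intro t
      have h1 := dfun_comp_curve (f := fun c => h (j c)) (hhj.mdifferentiableAt (γ t))
        (hγ.mdifferentiableAt (by simp) (x := t))
      have h2 : ∀ w ∈ intersectTangent V' j E (γ t), dfun V' (fun c => h (j c)) (γ t) w = 0 :=
        fun w hw => (dfun_comp (hh.1.mdifferentiableAt _)
          (hj.mdifferentiableAt (by simp)) w).trans
          ((Submodule.mem_dualAnnihilator _).1 (hh.2 (γ t)) _ ⟨hw, ⟨w, rfl⟩⟩)
      exact h1.congr_deriv (h2 _ (hγF t))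
    exact is_const_of_deriv_eq_zero (fun t => (hder t).differentiableAt) (fun t => (hder t).deriv)
      0 1
  | refl x => rfl
  | symm x y _ ih => exact ih.symm
  | trans x y z _ _ ih ih' => exact ih.trans ih'

theorem applyVF_eq_zero {C : Type*} {j : C → M}
    {E : ∀ c : C, Submodule ℝ (TangentSpace 𝓘(ℝ, V) (j c))}
    {X : ∀ p : M, TangentSpace 𝓘(ℝ, V) p} (hX : ∀ c, X (j c) ∈ E c) {f : M → ℝ}
    (hf : f ∈ AdaptedFun j E) (c : C) : applyVF X f (j c) = 0 :=
  (Submodule.mem_dualAnnihilator _).1 (hf.2 c) _ (hX c)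

section Sharp

variable [FiniteDimensional ℝ V]

theorem apply_sharp (π : ∀ p : M, Contra2 V p) (p : M) (ξ η : Cotangent V p) :
    η (sharp π p ξ) = π p ξ η :=
  Module.apply_evalEquiv_symm_apply (R := ℝ) (M := TangentSpace 𝓘(ℝ, V) p) η (π p ξ)

/-- If `♯ξ ∈ T + D`, then `π(ξ, η) = 0` for every `η` that annihilates `T` and `D`. -/
theorem bivector_apply_eq_zero {π : ∀ p : M, Contra2 V p} {p : M}
    {T D : Submodule ℝ (TangentSpace 𝓘(ℝ, V) p)} {ξ η : Cotangent V p}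
    (hξ : sharp π p ξ ∈ T ⊔ D) (hT : ∀ v ∈ T, η v = 0) (hD : ∀ v ∈ D, η v = 0) :
    π p ξ η = 0 := by
  obtain ⟨t, ht, d, hd, htd⟩ := Submodule.mem_sup.1 hξ
  rw [← apply_sharp, ← htd, map_add, hT t ht, hD d hd, add_zero]

/-- The value of the bivector on two covectors in `E°` depends only on their restrictions to
`TC`. -/
theorem bivector_apply_congr {π : ∀ p : M, Contra2 V p} {p : M} (hπ : (π p).IsAlt)
    {T D E : Submodule ℝ (TangentSpace 𝓘(ℝ, V) p)} (hDE : D ≤ E)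
    (hsharp : ∀ ξ ∈ E.dualAnnihilator, sharp π p ξ ∈ T ⊔ D)
    {ξ ξ' η η' : Cotangent V p} (hξ : ξ ∈ E.dualAnnihilator) (hξ' : ξ' ∈ E.dualAnnihilator)
    (hη : η ∈ E.dualAnnihilator) (hη' : η' ∈ E.dualAnnihilator)
    (hξT : ∀ v ∈ T, ξ v = ξ' v) (hηT : ∀ v ∈ T, η v = η' v) : π p ξ η = π p ξ' η' := by
  have h1 : π p ξ (η - η') = 0 := bivector_apply_eq_zero (hsharp ξ hξ)
    (fun v hv => sub_eq_zero.2 (hηT v hv))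
    (fun v hv => (Submodule.mem_dualAnnihilator _).1 (Submodule.sub_mem _ hη hη') v (hDE hv))
  have h2 : π p η' (ξ - ξ') = 0 := bivector_apply_eq_zero (hsharp η' hη')
    (fun v hv => sub_eq_zero.2 (hξT v hv))
    (fun v hv => (Submodule.mem_dualAnnihilator _).1 (Submodule.sub_mem _ hξ hξ') v (hDE hv))
  have h3 : π p η' ξ = -π p ξ η' := (hπ.neg ξ η').symm
  have h4 : π p η' ξ' = -π p ξ' η' := (hπ.neg ξ' η').symm
  rw [map_sub, sub_eq_zero] at h1 h2
  linarith

end Sharp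

/-! ### Lifts with vanishing second derivatives along `D` -/

variable [FiniteDimensional ℝ V] [IsManifold 𝓘(ℝ, V) ∞ M]

/-- If vector fields `X a` with values in `E` along `C` commute at `j c` as operators on adapted
functions, then every adapted function can be modified, without changing it on `C`, so that all
second derivatives `X b (X a f)` vanish at `j c`.

The matrix `B a b = X b (X a f)` at `j c` is symmetric, and `∑ b, x b * B a b = 0` whenever
`∑ b, x b • X b` is tangent to `C`, because `X a f` vanishes on `C`. Hence `B` is the Hessian along
the `X a` of a function `(1 / 2) * ∑ a b, B a b * u a * u b` with all `u a` vanishing on `C`, and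
subtracting that function changes neither values nor first derivatives along `C`. -/
theorem exists_adaptedFun_secondDeriv_eq_zero [T2Space M] {j : C → M}
    (hj : HasLocalRetractions V V' j) {E : ∀ c : C, Submodule ℝ (TangentSpace 𝓘(ℝ, V) (j c))}
    {r : ℕ} {X : Fin r → ∀ p : M, TangentSpace 𝓘(ℝ, V) p} (hX : ∀ a, SmoothVF (X a))
    (hXE : ∀ a c, X a (j c) ∈ E c) {f : M → ℝ} (hf : f ∈ AdaptedFun j E) (c : C)
    (hcomm : ∀ a b, applyVF (X a) (applyVF (X b) f) (j c) =
      applyVF (X b) (applyVF (X a) f) (j c)) :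
    ∃ f' ∈ AdaptedFun j E, (∀ c', f' (j c') = f (j c')) ∧
      ∀ a b, applyVF (X b) (applyVF (X a) f') (j c) = 0 := by
  let B : Fin r → Fin r → ℝ := fun a b => applyVF (X b) (applyVF (X a) f) (j c)
  have hBsymm : ∀ a b, B a b = B b a := fun a b => hcomm b a
  have hBT : ∀ x : Fin r → ℝ, ∑ b, x b • X b (j c) ∈ tangentImage V V' j c →
      ∀ a, ∑ b, x b * B a b = 0 := by
    intro x hx a
    have h1 := dfun_apply_tangentImage_eq_zero hj.smooth ((hX a).applyVF hf.1)
      (applyVF_eq_zero (hXE a) hf) hx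
    rw [map_sum] at h1
    rw [← h1]
    exact Finset.sum_congr rfl fun b _ =>
      (map_smul (dfun V (applyVF (X a) f) (j c)) (x b) (X b (j c))).symm
  -- `s` is a generalised inverse of `Z : ℝ^r → T_{j c} M / T_c C`, `x ↦ ∑ b, x b • X b`
  let T := tangentImage V V' j c
  let Z : (Fin r → ℝ) →ₗ[ℝ] (TangentSpace 𝓘(ℝ, V) (j c) ⧸ T) :=
    T.mkQ ∘ₗ Fintype.linearCombination ℝ fun a => X a (j c)
  obtain ⟨t, ht⟩ := Z.rangeRestrict.exists_rightInverse_of_surjective Z.range_rangeRestrict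
  obtain ⟨s, hs⟩ := LinearMap.exists_extend t
  have hZs : ∀ x, Z (s (Z x)) = Z x := by
    intro x
    have h1 : s (Z x) = t ⟨Z x, LinearMap.mem_range_self Z x⟩ := by
      rw [← hs]; rfl
    rw [h1]
    exact congrArg Subtype.val (LinearMap.congr_fun ht ⟨Z x, LinearMap.mem_range_self Z x⟩)
  let ξ : Fin r → Cotangent V (j c) := fun a => LinearMap.proj a ∘ₗ s ∘ₗ T.mkQ
  have hξT : ∀ a, ∀ v ∈ T, ξ a v = 0 := fun a v hv => by
    have : T.mkQ v = 0 := by rwa [Submodule.mkQ_apply, Submodule.Quotient.mk_eq_zero]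
    simp only [ξ, LinearMap.comp_apply, this, map_zero]
  have hξB : ∀ a d, ∑ b, B a b * ξ b (X d (j c)) = B a d := by
    intro a d
    have hZd : Z (Pi.single d 1) = T.mkQ (X d (j c)) := by
      simp [Z, Fintype.linearCombination_apply_single]
    have h1 : Z (s (T.mkQ (X d (j c))) - Pi.single d 1) = 0 := by
      rw [map_sub, ← hZd, hZs, sub_self]
    have h2 := hBT (s (T.mkQ (X d (j c))) - Pi.single d 1)
      ((Submodule.Quotient.mk_eq_zero T).1 h1) a
    simp only [Pi.sub_apply, sub_mul, Finset.sum_sub_distrib, Pi.single_apply, ite_mul, one_mul,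
      zero_mul, Finset.sum_ite_eq', Finset.mem_univ, if_true, sub_eq_zero] at h2
    rw [← h2]
    exact Finset.sum_congr rfl fun b _ => mul_comm _ _
  choose u hu hu0 hdu using fun a => hj.exists_vanishing c (ξ a) (hξT a)
  let q : Fin r → M → ℝ := fun a m => ∑ b, B a b * u b m
  have hq : ∀ a, SmoothFun V (q a) := fun a =>
    SmoothFun.sum _ fun b => (SmoothFun.const _).mul (hu b)
  have hq0 : ∀ a c', q a (j c') = 0 := fun a c' => by simp [q, hu0]
  have hdq : ∀ a d, applyVF (X d) (q a) (j c) = B a d := by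
    intro a d
    rw [← hξB a d]
    change dfun V (q a) (j c) (X d (j c)) = _
    rw [(dfun_sum Finset.univ fun b _ =>
      ((SmoothFun.const (B a b)).mul (hu b)).mdifferentiableAt (j c)).2, LinearMap.sum_apply]
    refine Finset.sum_congr rfl fun b _ => ?_
    rw [dfun_mul mdifferentiableAt_const ((hu b).mdifferentiableAt _), dfun_const, smul_zero,
      add_zero, hdu]
    rfl
  have hdu' : ∀ a d, applyVF (X d) (u a) (j c) = ξ a (X d (j c)) := fun a d =>
    LinearMap.congr_fun (hdu a) _
  let φ : M → ℝ := fun m => ∑ a, u a m * q a m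
  have huq : ∀ a, SmoothFun V fun m => u a m * q a m := fun a => (hu a).mul (hq a)
  have hφ : SmoothFun V φ := SmoothFun.sum _ huq
  have hdφ : ∀ m, dfun V φ m = ∑ a, (u a m • dfun V (q a) m + q a m • dfun V (u a) m) := by
    intro m
    rw [(dfun_sum Finset.univ fun a _ => (huq a).mdifferentiableAt m).2]
    exact Finset.sum_congr rfl fun a _ =>
      dfun_mul ((hu a).mdifferentiableAt m) ((hq a).mdifferentiableAt m)
  have hXφ : ∀ e, applyVF (X e) φ = fun m =>
      ∑ a, (u a m * applyVF (X e) (q a) m + q a m * applyVF (X e) (u a) m) := by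
    intro e
    funext m
    change dfun V φ m (X e m) = _
    rw [hdφ, LinearMap.sum_apply]
    rfl
  have hXXφ : ∀ e d, applyVF (X d) (applyVF (X e) φ) (j c) = 2 * B e d := by
    intro e d
    have hA : ∀ a, SmoothFun V (applyVF (X e) (q a)) := fun a => (hX e).applyVF (hq a)
    have hA' : ∀ a, SmoothFun V (applyVF (X e) (u a)) := fun a => (hX e).applyVF (hu a)
    rw [hXφ]
    change dfun V _ (j c) (X d (j c)) = _
    rw [(dfun_sum Finset.univ fun a _ =>
      (((hu a).mul (hA a)).add ((hq a).mul (hA' a))).mdifferentiableAt (j c)).2,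
      LinearMap.sum_apply]
    have hterm : ∀ a, dfun V (fun m => u a m * applyVF (X e) (q a) m +
        q a m * applyVF (X e) (u a) m) (j c) (X d (j c)) =
        B e a * ξ a (X d (j c)) + B d a * ξ a (X e (j c)) := by
      intro a
      rw [dfun_add (((hu a).mul (hA a)).mdifferentiableAt _)
        (((hq a).mul (hA' a)).mdifferentiableAt _),
        dfun_mul ((hu a).mdifferentiableAt _) ((hA a).mdifferentiableAt _),
        dfun_mul ((hq a).mdifferentiableAt _) ((hA' a).mdifferentiableAt _),
        hu0, hq0, zero_smul, zero_add, zero_smul, zero_add, hdq, hdu', hdu,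
        LinearMap.add_apply, LinearMap.smul_apply, LinearMap.smul_apply, smul_eq_mul, smul_eq_mul]
      have h1 : dfun V (q a) (j c) (X d (j c)) = B a d := hdq a d
      rw [h1, hBsymm a e, hBsymm a d]
      ring
    rw [Finset.sum_congr rfl fun a _ => hterm a, Finset.sum_add_distrib, hξB, hξB, hBsymm d e]
    ring
  have hhφ : SmoothFun V fun m => (1 / 2 : ℝ) * φ m := (SmoothFun.const _).mul hφ
  have hdhφ : ∀ m, dfun V (fun m => (1 / 2 : ℝ) * φ m) m = (1 / 2 : ℝ) • dfun V φ m := by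
    intro m
    rw [dfun_mul mdifferentiableAt_const (hφ.mdifferentiableAt m), dfun_const, smul_zero, add_zero]
  have hdf' : ∀ m, dfun V (fun m => f m - (1 / 2 : ℝ) * φ m) m =
      dfun V f m - (1 / 2 : ℝ) • dfun V φ m := by
    intro m
    rw [dfun_sub (hf.1.mdifferentiableAt m) (hhφ.mdifferentiableAt m), hdhφ]
  refine ⟨fun m => f m - (1 / 2 : ℝ) * φ m, ⟨hf.1.sub hhφ, fun c' => ?_⟩, fun c' => ?_, ?_⟩
  · have : dfun V φ (j c') = 0 := by simp [hdφ, hu0, hq0]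
    rw [hdf', this, smul_zero, sub_zero]
    exact hf.2 c'
  · simp [φ, hu0]
  · intro a b
    have h1 : applyVF (X a) (fun m => f m - (1 / 2 : ℝ) * φ m) = fun m =>
        applyVF (X a) f m - (1 / 2 : ℝ) * applyVF (X a) φ m := by
      funext m
      change dfun V _ m (X a m) = _
      rw [hdf']
      rfl
    have hXaφ := (hX a).applyVF hφ
    rw [h1]
    change dfun V _ (j c) (X b (j c)) = 0
    rw [dfun_sub (((hX a).applyVF hf.1).mdifferentiableAt _)
      (((SmoothFun.const (1 / 2 : ℝ)).mul hXaφ).mdifferentiableAt _),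
      dfun_mul mdifferentiableAt_const (hXaφ.mdifferentiableAt _), dfun_const, smul_zero, add_zero]
    have h2 : dfun V (applyVF (X a) φ) (j c) (X b (j c)) = 2 * B a b := hXXφ a b
    have h3 : dfun V (applyVF (X a) f) (j c) (X b (j c)) = B a b := rfl
    rw [LinearMap.sub_apply, LinearMap.smul_apply, h2, h3, smul_eq_mul]
    ring

/-- If all second derivatives of `f` and `g` along a frame `X a` of `D` vanish at `j c`, then the
differential of `{f, g}` at `j c` annihilates `D`: by the Leibniz rule for `L_X π` only the terms
`{X a f, g}` and `{f, X a g}` matter, and `X a f` vanishes on `C` together with its derivatives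
along `D`. -/
theorem dfun_bracket_apply_eq_zero {j : C → M} (hj : ContMDiff 𝓘(ℝ, V') 𝓘(ℝ, V) ∞ j)
    (P : PoissonStructure V M)
    {E : ∀ c : C, Submodule ℝ (TangentSpace 𝓘(ℝ, V) (j c))}
    {r : ℕ} {X : Fin r → ∀ p : M, TangentSpace 𝓘(ℝ, V) p} (hX : ∀ a, SmoothVF (X a))
    (hXE : ∀ a c, X a (j c) ∈ E c) {c : C}
    (hLie : ∀ a, ∃ Λ ∈ wedgeTangent (E c), IsLieDerivAt (X a) P.bivector (j c) Λ)
    (hsharp : ∀ ξ ∈ (E c).dualAnnihilator, sharp P.bivector (j c) ξ ∈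
      tangentImage V V' j c ⊔ Submodule.span ℝ (range fun a => X a (j c)))
    {f g : M → ℝ} (hf : f ∈ AdaptedFun j E) (hg : g ∈ AdaptedFun j E)
    (hf2 : ∀ a b, applyVF (X b) (applyVF (X a) f) (j c) = 0)
    (hg2 : ∀ a b, applyVF (X b) (applyVF (X a) g) (j c) = 0) :
    ∀ v ∈ Submodule.span ℝ (range fun a => X a (j c)),
      dfun V (bracket P.bivector f g) (j c) v = 0 := by
  have hzero : ∀ f g : M → ℝ, f ∈ AdaptedFun j E → g ∈ AdaptedFun j E →
      (∀ a b, applyVF (X b) (applyVF (X a) g) (j c) = 0) →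
      ∀ a, bracket P.bivector f (applyVF (X a) g) (j c) = 0 := by
    intro f g hf hg hg2 a
    refine bivector_apply_eq_zero (hsharp _ (hf.2 c)) (fun v hv =>
      dfun_apply_tangentImage_eq_zero hj ((hX a).applyVF hg.1) (applyVF_eq_zero (hXE a) hg) hv) ?_
    intro v hv
    refine LinearMap.mem_ker.1 ((Submodule.span_le.2 ?_ :
      _ ≤ LinearMap.ker (dfun V (applyVF (X a) g) (j c))) hv)
    rintro _ ⟨b, rfl⟩
    exact LinearMap.mem_ker.2 (hg2 a b)
  intro v hv
  refine LinearMap.mem_ker.1 ((Submodule.span_le.2 ?_ :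
    _ ≤ LinearMap.ker (dfun V (bracket P.bivector f g) (j c))) hv)
  rintro _ ⟨a, rfl⟩
  refine LinearMap.mem_ker.2 ?_
  obtain ⟨Λ, hΛ, hΛX⟩ := hLie a
  have h1 := hΛX f g hf.1 hg.1
  rw [wedgeTangent_apply_eq_zero hΛ (hf.2 c) (hg.2 c)] at h1
  have h2 : bracket P.bivector f (applyVF (X a) g) (j c) = 0 := hzero f g hf hg hg2 a
  have h3 : bracket P.bivector (applyVF (X a) f) g (j c) = 0 := by
    have h4 : bracket P.bivector (applyVF (X a) f) g (j c) =
        -bracket P.bivector g (applyVF (X a) f) (j c) := ((P.alternating _).neg _ _).symm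
    rw [h4, hzero g f hg hf hf2 a, neg_zero]
  unfold lieDerivOnFun at h1
  rw [h2, h3, sub_zero, sub_zero] at h1
  exact h1.symm

end Bracket

/-! ### Vector fields tangent to a submanifold -/

section Related

variable {V : Type*} [NormedAddCommGroup V] [NormedSpace ℝ V]
  {M : Type*} [TopologicalSpace M] [ChartedSpace V M]
  {V' : Type*} [NormedAddCommGroup V'] [NormedSpace ℝ V']
  {A : Type*} [TopologicalSpace A] [ChartedSpace V' A]

theorem tangentMap_eq_self {f : A → A} {w : TangentBundle 𝓘(ℝ, V') A}
    (hf : f =ᶠ[𝓝 w.1] id) : tangentMap 𝓘(ℝ, V') 𝓘(ℝ, V') f w = w := by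
  have h1 : f w.1 = w.1 := hf.self_of_nhds
  have h2 : HasMFDerivAt 𝓘(ℝ, V') 𝓘(ℝ, V') f w.1
      (ContinuousLinearMap.id ℝ (TangentSpace 𝓘(ℝ, V') w.1)) :=
    (hasMFDerivAt_id w.1).congr_of_eventuallyEq hf
  have h3 : (mfderiv 𝓘(ℝ, V') 𝓘(ℝ, V') f w.1 w.2 : V') = w.2 := by
    rw [h2.mfderiv]
    rfl
  exact Bundle.TotalSpace.ext h1 (HEq.trans (b := (w.2 : V')) (heq_of_eq h3) HEq.rfl)

variable [IsManifold 𝓘(ℝ, V) ∞ M] [IsManifold 𝓘(ℝ, V') ∞ A]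

/-- A vector field on a submanifold `A` is smooth if it is related to a smooth vector field on the
ambient manifold. -/
theorem SmoothVF.of_related {k : A → M} (hk : HasLocalRetractions V V' k)
    {X : ∀ p : M, TangentSpace 𝓘(ℝ, V) p} (hX : SmoothVF X)
    {Z : ∀ a : A, TangentSpace 𝓘(ℝ, V') a}
    (hZ : ∀ a, mfderiv 𝓘(ℝ, V') 𝓘(ℝ, V) k a (Z a) = X (k a)) : SmoothVF Z := by
  intro a₀
  obtain ⟨O, hO, haO, p, hp, hpk⟩ := hk.exists_retraction a₀
  have hkO : k ⁻¹' O ∈ 𝓝 a₀ := (hO.preimage hk.smooth.continuous).mem_nhds haO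
  have h1 : ContMDiffOn 𝓘(ℝ, V).tangent 𝓘(ℝ, V').tangent ∞
      (tangentMapWithin 𝓘(ℝ, V) 𝓘(ℝ, V') p O) (Bundle.TotalSpace.proj ⁻¹' O) :=
    hp.contMDiffOn_tangentMapWithin (by simp) hO.uniqueMDiffOn
  have h2 : ContMDiff 𝓘(ℝ, V') 𝓘(ℝ, V).tangent ∞
      (fun a => (⟨k a, X (k a)⟩ : TangentBundle 𝓘(ℝ, V) M)) := ContMDiff.comp hX hk.smooth
  have h3 : ContMDiffOn 𝓘(ℝ, V') 𝓘(ℝ, V').tangent ∞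
      (fun a => tangentMapWithin 𝓘(ℝ, V) 𝓘(ℝ, V') p O ⟨k a, X (k a)⟩) (k ⁻¹' O) :=
    h1.comp h2.contMDiffOn fun a ha => ha
  refine (h3.contMDiffAt hkO).congr_of_eventuallyEq ?_
  filter_upwards [(hO.preimage hk.smooth.continuous).mem_nhds haO] with a ha
  have hpa : MDifferentiableAt 𝓘(ℝ, V) 𝓘(ℝ, V') p (k a) :=
    ((hp _ ha).contMDiffAt (hO.mem_nhds ha)).mdifferentiableAt (by simp)
  have hka : MDifferentiableAt 𝓘(ℝ, V') 𝓘(ℝ, V) k a := hk.smooth.mdifferentiableAt (by simp)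
  have h4 : tangentMapWithin 𝓘(ℝ, V) 𝓘(ℝ, V') p O ⟨k a, X (k a)⟩ =
      tangentMap 𝓘(ℝ, V) 𝓘(ℝ, V') p ⟨k a, X (k a)⟩ :=
    tangentMapWithin_eq_tangentMap (hO.uniqueMDiffOn _ ha) hpa
  have h5 : (⟨k a, X (k a)⟩ : TangentBundle 𝓘(ℝ, V) M) =
      tangentMap 𝓘(ℝ, V') 𝓘(ℝ, V) k ⟨a, Z a⟩ := by
    rw [← hZ a]; rfl
  have h6 := tangentMap_comp_at (I := 𝓘(ℝ, V')) (I' := 𝓘(ℝ, V)) (I'' := 𝓘(ℝ, V')) (f := k) (g := p)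
    (⟨a, Z a⟩ : TangentBundle 𝓘(ℝ, V') A) hpa hka
  rw [h4, h5, ← h6]
  refine (tangentMap_eq_self ?_).symm
  filter_upwards [(hO.preimage hk.smooth.continuous).mem_nhds ha] with a' ha' using hpk _ ha'

/-- Vector fields on `M` that restrict to sections of an involutive distribution `D` on a
submanifold `A` commute, at a point of `A`, on functions whose differential there annihilates
`D`. -/
theorem applyVF_comm_of_isInvolutive [CompleteSpace V'] {k : A → M}
    (hk : HasLocalRetractions V V' k) {D : ∀ a : A, Submodule ℝ (TangentSpace 𝓘(ℝ, V') a)}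
    (hD : IsInvolutive D) {X Y : ∀ p : M, TangentSpace 𝓘(ℝ, V) p} (hX : SmoothVF X)
    (hY : SmoothVF Y) (hXD : ∀ a, X (k a) ∈ pushSubspace k D a)
    (hYD : ∀ a, Y (k a) ∈ pushSubspace k D a) {f : M → ℝ} (hf : SmoothFun V f) {a : A}
    (hfD : ∀ v ∈ pushSubspace k D a, dfun V f (k a) v = 0) :
    applyVF X (applyVF Y f) (k a) = applyVF Y (applyVF X f) (k a) := by
  choose Z hZD hZ using hXD
  choose W hWD hW using hYD
  have hZs : SmoothVF Z := hX.of_related hk hZ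
  have hWs : SmoothVF W := hY.of_related hk hW
  have hrel : ∀ (X : ∀ p : M, TangentSpace 𝓘(ℝ, V) p) (Z : ∀ a : A, TangentSpace 𝓘(ℝ, V') a),
      (∀ a, mfderiv 𝓘(ℝ, V') 𝓘(ℝ, V) k a (Z a) = X (k a)) → ∀ g : M → ℝ, SmoothFun V g →
      applyVF Z (fun a => g (k a)) = fun a => applyVF X g (k a) := by
    intro X Z hZ g hg
    funext a
    refine (dfun_comp (hg.mdifferentiableAt _) (hk.smooth.mdifferentiableAt (by simp)) _).trans ?_
    rw [hZ]
    rfl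
  have hfk : SmoothFun V' fun a => f (k a) := ContMDiff.comp hf hk.smooth
  have h1 := dfun_mlieBracket hZs hWs hfk a
  rw [hrel X Z hZ f hf, hrel Y W hW f hf, hrel X Z hZ _ (hY.applyVF hf),
    hrel Y W hW _ (hX.applyVF hf)] at h1
  have h2 := (dfun_comp (hf.mdifferentiableAt _) (hk.smooth.mdifferentiableAt (by simp))
    (VectorField.mlieBracket 𝓘(ℝ, V') Z W a)).trans
    (hfD _ ⟨_, hD Z W hZs hWs hZD hWD a, rfl⟩)
  exact sub_eq_zero.1 (h1.symm.trans h2)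

end Related

/-! ### The quotient Poisson structure -/

section Quotient

variable {V : Type*} [NormedAddCommGroup V] [NormedSpace ℝ V] [FiniteDimensional ℝ V]
  {M : Type*} [TopologicalSpace M] [ChartedSpace V M]
  {V' : Type*} [NormedAddCommGroup V'] [NormedSpace ℝ V']
  {C : Type*} [TopologicalSpace C] [ChartedSpace V' C]
  {VN : Type*} [NormedAddCommGroup VN] [NormedSpace ℝ VN] [FiniteDimensional ℝ VN]
  {N : Type*} [TopologicalSpace N] [ChartedSpace VN N] [IsManifold 𝓘(ℝ, VN) ∞ N] [T2Space N]

/-- A Poisson structure is determined by its brackets of smooth functions. -/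
theorem PoissonStructure.ext_bracket {Q Q' : PoissonStructure VN N}
    (h : ∀ f g : N → ℝ, SmoothFun VN f → SmoothFun VN g →
      bracket Q.bivector f g = bracket Q'.bivector f g) : Q = Q' := by
  have : Q.bivector = Q'.bivector := by
    funext p
    ext ξ η
    obtain ⟨f, hf, rfl⟩ := exists_smoothFun_dfun_eq p ξ
    obtain ⟨g, hg, rfl⟩ := exists_smoothFun_dfun_eq p η
    exact congrFun (h f g hf hg) p
  cases Q
  cases Q'
  cases this
  rfl

/-- Reduction in terms of adapted lifts. The bracket descends because it is constant on leaves,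
and depends only on the functions on the quotient by `♯E° ⊆ TC + D` and `D ⊆ E`. For the Jacobi
identity one needs lifts whose bracket has a differential that annihilates `D` at the given point:
such a bracket can replace an adapted lift of the reduced bracket inside a further bracket with an
adapted function. -/
theorem existsUnique_quotient_poissonStructure {j : C → M} (hj : ContMDiff 𝓘(ℝ, V') 𝓘(ℝ, V) ∞ j)
    (P : PoissonStructure V M) {E D : ∀ c : C, Submodule ℝ (TangentSpace 𝓘(ℝ, V) (j c))}
    (hDE : ∀ c, D c ≤ E c) {pr : C → N} (hpr : IsLeafSpace (V := VN) (intersectTangent V' j E) pr)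
    (hlift : ∀ f : N → ℝ, SmoothFun VN f → ∃ f' ∈ AdaptedFun j E, ∀ c, f' (j c) = f (pr c))
    (hEEF : ∀ f ∈ AdaptedFun j E, ∀ g ∈ AdaptedFun j E,
      bracket P.bivector f g ∈ AdaptedFun j fun c => E c ⊓ tangentImage V V' j c)
    (hsharp : ∀ c, ∀ ξ ∈ (E c).dualAnnihilator,
      sharp P.bivector (j c) ξ ∈ tangentImage V V' j c ⊔ D c)
    (hgood : ∀ c, ∃ G : Set (M → ℝ), G ⊆ AdaptedFun j E ∧
      (∀ f : N → ℝ, SmoothFun VN f → ∃ f' ∈ G, ∀ c, f' (j c) = f (pr c)) ∧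
      ∀ f ∈ G, ∀ g ∈ G, ∀ v ∈ D c, dfun V (bracket P.bivector f g) (j c) v = 0) :
    ∃! Q : PoissonStructure VN N,
      ∀ f g : N → ℝ, SmoothFun VN f → SmoothFun VN g →
        ∀ f' ∈ AdaptedFun j E, ∀ g' ∈ AdaptedFun j E,
          (∀ c, f' (j c) = f (pr c)) → (∀ c, g' (j c) = g (pr c)) →
          ∀ c, bracket Q.bivector f g (pr c) = bracket P.bivector f' g' (j c) := by
  have hprs : ContMDiff 𝓘(ℝ, V') 𝓘(ℝ, VN) ∞ pr := fun c =>
    (hpr.submersion.isSubmersionAt c).contMDiffAt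
  have hjd : ∀ c, MDifferentiableAt 𝓘(ℝ, V') 𝓘(ℝ, V) j c := fun c =>
    hj.mdifferentiableAt (by simp)
  have hprd : ∀ c, MDifferentiableAt 𝓘(ℝ, V') 𝓘(ℝ, VN) pr c := fun c =>
    hprs.mdifferentiableAt (by simp)
  -- a linear choice, for covectors `ξ` at a point of the quotient, of covectors in `E°` that
  -- restrict to the pullback of `ξ` on `TC`
  have hlam : ∀ n : N, ∃ c, pr c = n ∧ ∃ l : Cotangent VN n →ₗ[ℝ] Cotangent V (j c),
      ∀ f : N → ℝ, SmoothFun VN f → ∀ f' ∈ AdaptedFun j E, (∀ c, f' (j c) = f (pr c)) →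
        l (dfun VN f n) ∈ (E c).dualAnnihilator ∧
          ∀ v ∈ tangentImage V V' j c, l (dfun VN f n) v = dfun V f' (j c) v := by
    intro n
    obtain ⟨c, rfl⟩ := hpr.surjective n
    let S : Submodule ℝ (Cotangent VN (pr c) × Cotangent V (j c)) :=
      { carrier := {z | z.2 ∈ (E c).dualAnnihilator ∧ ∀ v : TangentSpace 𝓘(ℝ, V') c,
          z.2 (mfderiv 𝓘(ℝ, V') 𝓘(ℝ, V) j c v) = z.1 (mfderiv 𝓘(ℝ, V') 𝓘(ℝ, VN) pr c v)}
        add_mem' := fun {z w} hz hw => ⟨Submodule.add_mem _ hz.1 hw.1, fun v => by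
          simp only [Prod.snd_add, Prod.fst_add, LinearMap.add_apply, hz.2 v, hw.2 v]⟩
        zero_mem' := ⟨Submodule.zero_mem _, fun v => rfl⟩
        smul_mem' := fun a z hz => ⟨Submodule.smul_mem _ a hz.1, fun v => by
          simp only [Prod.smul_snd, Prod.smul_fst, LinearMap.smul_apply, hz.2 v]⟩ }
    have hSlift : ∀ f : N → ℝ, SmoothFun VN f → ∀ f' ∈ AdaptedFun j E,
        (∀ c, f' (j c) = f (pr c)) → (dfun VN f (pr c), dfun V f' (j c)) ∈ S := by
      intro f hf f' hf' hff'
      refine ⟨hf'.2 c, fun v => ?_⟩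
      have h1 := dfun_comp (hf'.1.mdifferentiableAt _) (hjd c) v
      have h2 := dfun_comp (hf.mdifferentiableAt _) (hprd c) v
      simp only [hff'] at h1
      exact h1.symm.trans h2
    have hsurj : LinearMap.range ((LinearMap.fst ℝ (Cotangent VN (pr c))
        (Cotangent V (j c))).domRestrict S) = ⊤ := by
      refine LinearMap.range_eq_top.2 fun ξ => ?_
      obtain ⟨f, hf, rfl⟩ := exists_smoothFun_dfun_eq (pr c) ξ
      obtain ⟨f', hf', hff'⟩ := hlift f hf
      exact ⟨⟨_, hSlift f hf f' hf' hff'⟩, rfl⟩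
    obtain ⟨t, ht⟩ := LinearMap.exists_rightInverse_of_surjective _ hsurj
    refine ⟨c, rfl, LinearMap.snd ℝ _ _ ∘ₗ S.subtype ∘ₗ t, fun f hf f' hf' hff' => ?_⟩
    have h1 : (t (dfun VN f (pr c))).1.1 = dfun VN f (pr c) := LinearMap.congr_fun ht _
    obtain ⟨h2, h3⟩ := (t (dfun VN f (pr c))).2
    refine ⟨h2, ?_⟩
    rintro _ ⟨v, rfl⟩
    refine (h3 v).trans ?_
    rw [h1]
    exact ((hSlift f hf f' hf' hff').2 v).symm
  choose σ hσ l hl using hlam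
  let q : ∀ n : N, Contra2 VN n := fun n => (P.bivector (j (σ n))).compl₁₂ (l n) (l n)
  have hq : ∀ f g : N → ℝ, SmoothFun VN f → SmoothFun VN g →
      ∀ f' ∈ AdaptedFun j E, ∀ g' ∈ AdaptedFun j E,
        (∀ c, f' (j c) = f (pr c)) → (∀ c, g' (j c) = g (pr c)) →
        ∀ c, bracket q f g (pr c) = bracket P.bivector f' g' (j c) := by
    intro f g hf hg f' hf' g' hg' hff' hgg' c
    obtain ⟨hf1, hf2⟩ := hl (pr c) f hf f' hf' hff'
    obtain ⟨hg1, hg2⟩ := hl (pr c) g hg g' hg' hgg'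
    have h1 : bracket q f g (pr c) = bracket P.bivector f' g' (j (σ (pr c))) :=
      bivector_apply_congr (P.alternating _) (hDE _) (hsharp _) hf1 (hf'.2 _) hg1 (hg'.2 _) hf2 hg2
    rw [h1]
    exact AdaptedFun.eq_of_sameLeaf hj (hEEF f' hf' g' hg') ((hpr.fibre _ _).1 (hσ (pr c)))
  have hqs : ∀ f g : N → ℝ, SmoothFun VN f → SmoothFun VN g → SmoothFun VN (bracket q f g) := by
    intro f g hf hg
    obtain ⟨f', hf', hff'⟩ := hlift f hf
    obtain ⟨g', hg', hgg'⟩ := hlift g hg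
    refine smoothFun_of_comp_submersion hpr.surjective hpr.submersion ?_
    simp only [hq f g hf hg f' hf' g' hg' hff' hgg']
    exact ContMDiff.comp (P.smooth f' g' hf'.1 hg'.1) hj
  let Q : PoissonStructure VN N :=
    { bivector := q
      alternating := fun n ξ => P.alternating _ (l n ξ)
      smooth := hqs
      jacobi := by
        intro f g h hf hg hh n
        obtain ⟨c, rfl⟩ := hpr.surjective n
        obtain ⟨G, hGE, hGlift, hGD⟩ := hgood c
        obtain ⟨f', hf', hff'⟩ := hGlift f hf
        obtain ⟨g', hg', hgg'⟩ := hGlift g hg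
        obtain ⟨h', hh', hhh'⟩ := hGlift h hh
        -- inside a further bracket, `{a', b'}` replaces an adapted lift `u` of `{a, b}`
        have key : ∀ (a b e : N → ℝ) (a' b' e' : M → ℝ), SmoothFun VN a → SmoothFun VN b →
            SmoothFun VN e → a' ∈ G → b' ∈ G → e' ∈ G → (∀ c, a' (j c) = a (pr c)) →
            (∀ c, b' (j c) = b (pr c)) → (∀ c, e' (j c) = e (pr c)) →
            bracket q (bracket q a b) e (pr c) =
              bracket P.bivector (bracket P.bivector a' b') e' (j c) := by
          intro a b e a' b' e' ha hb he ha' hb' he' haa' hbb' hee'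
          obtain ⟨u, hu, huu⟩ := hlift _ (hqs a b ha hb)
          have hab := hEEF a' (hGE ha') b' (hGE hb')
          have huab : ∀ c, u (j c) = bracket P.bivector a' b' (j c) := fun c => by
            rw [huu c, hq a b ha hb a' (hGE ha') b' (hGE hb') haa' hbb']
          rw [hq _ e (hqs a b ha hb) he u hu e' (hGE he') huu hee' c]
          have h1 : P.bivector (j c) (dfun V e' (j c))
              (dfun V u (j c) - dfun V (bracket P.bivector a' b') (j c)) = 0 := by
            refine bivector_apply_eq_zero (hsharp c _ ((hGE he').2 c)) (fun v hv => ?_)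
              fun v hv => ?_
            · rw [LinearMap.sub_apply, dfun_apply_tangentImage hj hu.1 hab.1 huab hv, sub_self]
            · rw [LinearMap.sub_apply, hGD a' ha' b' hb' v hv, sub_zero]
              exact (Submodule.mem_dualAnnihilator _).1 (hu.2 c) v (hDE c hv)
          rw [map_sub, sub_eq_zero] at h1
          have h2 := (P.alternating (j c)).neg (dfun V e' (j c)) (dfun V u (j c))
          have h3 := (P.alternating (j c)).neg (dfun V e' (j c))
            (dfun V (bracket P.bivector a' b') (j c))
          change P.bivector (j c) (dfun V u (j c)) (dfun V e' (j c)) =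
            P.bivector (j c) (dfun V (bracket P.bivector a' b') (j c)) (dfun V e' (j c))
          rw [← h2, ← h3, h1]
        rw [key f g h f' g' h' hf hg hh hf' hg' hh' hff' hgg' hhh',
          key g h f g' h' f' hg hh hf hg' hh' hf' hgg' hhh' hff',
          key h f g h' f' g' hh hf hg hh' hf' hg' hhh' hff' hgg']
        exact P.jacobi f' g' h' (hGE hf').1 (hGE hg').1 (hGE hh').1 (j c) }
  refine ⟨Q, hq, fun Q' hQ' => PoissonStructure.ext_bracket fun f g hf hg => ?_⟩
  funext n
  obtain ⟨c, rfl⟩ := hpr.surjective n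
  obtain ⟨f', hf', hff'⟩ := hlift f hf
  obtain ⟨g', hg', hgg'⟩ := hlift g hg
  rw [hQ' f g hf hg f' hf' g' hg' hff' hgg' c]
  exact (hq f g hf hg f' hf' g' hg' hff' hgg' c).symm

end Quotient
end PoissonReduction

theorem mainTheorem2
    -- the Poisson manifold `M`
    {V : Type*} [NormedAddCommGroup V] [NormedSpace ℝ V] [FiniteDimensional ℝ V]
    {M : Type*} [TopologicalSpace M] [ChartedSpace V M] [IsManifold 𝓘(ℝ, V) ∞ M]
    [T2Space M] [SecondCountableTopology M]
    (P : PoissonStructure V M)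
    -- the submanifold `k : A → M`
    {VA : Type*} [NormedAddCommGroup VA] [NormedSpace ℝ VA] [FiniteDimensional ℝ VA]
    {A : Type*} [TopologicalSpace A] [ChartedSpace VA A] [IsManifold 𝓘(ℝ, VA) ∞ A]
    (k : A → M) (hk : Manifold.IsSmoothEmbedding 𝓘(ℝ, VA) 𝓘(ℝ, V) ∞ k)
    -- the submanifold `k ∘ i : C → M`, contained in `A` and closed in `M`
    {VC : Type*} [NormedAddCommGroup VC] [NormedSpace ℝ VC] [FiniteDimensional ℝ VC]
    {C : Type*} [TopologicalSpace C] [ChartedSpace VC C] [IsManifold 𝓘(ℝ, VC) ∞ C]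
    (i : C → A) (hi : Manifold.IsSmoothEmbedding 𝓘(ℝ, VC) 𝓘(ℝ, VA) ∞ i)
    (hclosed : IsClosed (Set.range (k ∘ i)))
    -- the subbundle `E` of `TM|_C`, with `F = E ∩ TC` involutive and of constant rank
    (E : ∀ c : C, Submodule ℝ (TangentSpace 𝓘(ℝ, V) (k (i c))))
    (hE : IsSmoothSubbundle VC (k ∘ i) E)
    (hF_rank : IsLocallyConstant fun c =>
      Module.finrank ℝ ↥(E c ⊓ tangentImage V VC (k ∘ i) c))
    (hF_inv : IsInvolutive (intersectTangent VC (k ∘ i) E))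
    -- the smooth quotient `pr : C → N` of `C` by `F`
    {VN : Type*} [NormedAddCommGroup VN] [NormedSpace ℝ VN] [FiniteDimensional ℝ VN]
    {N : Type*} [TopologicalSpace N] [ChartedSpace VN N] [IsManifold 𝓘(ℝ, VN) ∞ N]
    [T2Space N] [SecondCountableTopology N]
    (pr : C → N) (hpr : IsLeafSpace (V := VN) (intersectTangent VC (k ∘ i) E) pr)
    -- the integrable (involutive) distribution `D` on `A`, with `D|_C ⊆ E`
    (D : ∀ a : A, Submodule ℝ (TangentSpace 𝓘(ℝ, VA) a))
    (hD : IsSmoothSubbundle VA id D) (hD_inv : IsInvolutive D)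
    (hDE : ∀ c, pushSubspace k D (i c) ≤ E c)
    -- the three compatibility conditions
    (hDC_rank : IsLocallyConstant fun c =>
      Module.finrank ℝ ↥(pushSubspace k D (i c) ⊓ tangentImage V VC (k ∘ i) c))
    (hEA_rank : IsLocallyConstant fun c =>
      Module.finrank ℝ ↥(E c ⊓ tangentImage V VA k (i c)))
    (hflow : FlowsPreserve VC i k D E)
    -- `{C^∞_E, C^∞_E} ⊆ C^∞_F`
    (hEEF : ∀ f ∈ AdaptedFun (k ∘ i) E, ∀ g ∈ AdaptedFun (k ∘ i) E,
      bracket P.bivector f g ∈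
        AdaptedFun (k ∘ i) (fun c => E c ⊓ tangentImage V VC (k ∘ i) c))
    -- `(L_{X_a} π)|_C ⊆ E ∧ TM|_C`, for vector fields `X_a` on `M` with `X_a|_A ∈ D` that form
    -- a frame of `D|_C` near a given point of `C`
    (hLie : ∀ c₀ : C, ∃ (r : ℕ) (X : Fin r → ∀ p : M, TangentSpace 𝓘(ℝ, V) p),
      (∀ a, SmoothVF (X a)) ∧ (∀ a x, X a (k x) ∈ pushSubspace k D x) ∧
      ∀ᶠ c in 𝓝 c₀,
        LinearIndependent ℝ (fun a => X a (k (i c))) ∧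
        Submodule.span ℝ (Set.range fun a => X a (k (i c))) = pushSubspace k D (i c) ∧
        ∀ a, ∃ Λ ∈ wedgeTangent (E c), IsLieDerivAt (X a) P.bivector (k (i c)) Λ)
    -- `♯E° ⊆ TC + D|_C`
    (hsharp : ∀ c, ∀ ξ ∈ (E c).dualAnnihilator,
      sharp P.bivector (k (i c)) ξ ∈
        tangentImage V VC (k ∘ i) c ⊔ pushSubspace k D (i c)) :
    -- functions on the quotient lift to `C^∞_E(M)`, and there is exactly one Poisson structure on
    -- the quotient whose bracket is computed by such lifts
    (∀ f : N → ℝ, SmoothFun VN f →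
      ∃ f' ∈ AdaptedFun (k ∘ i) E, ∀ c, f' (k (i c)) = f (pr c)) ∧
    ∃! Q : PoissonStructure VN N,
      ∀ f g : N → ℝ, SmoothFun VN f → SmoothFun VN g →
        ∀ f' ∈ AdaptedFun (k ∘ i) E, ∀ g' ∈ AdaptedFun (k ∘ i) E,
          (∀ c, f' (k (i c)) = f (pr c)) → (∀ c, g' (k (i c)) = g (pr c)) →
          ∀ c, bracket Q.bivector f g (pr c) = bracket P.bivector f' g' (k (i c)) := by
  have hkr := hasLocalRetractions_of_isSmoothEmbedding hk
  have hj := hkr.comp (hasLocalRetractions_of_isSmoothEmbedding hi)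
  have hprs : ContMDiff 𝓘(ℝ, VC) 𝓘(ℝ, VN) ∞ pr := fun c =>
    (hpr.submersion.isSubmersionAt c).contMDiffAt
  have hlift : ∀ f : N → ℝ, SmoothFun VN f →
      ∃ f' ∈ AdaptedFun (k ∘ i) E, ∀ c, f' (k (i c)) = f (pr c) := by
    intro f hf
    refine exists_adaptedFun_lift hj hclosed hE hF_rank (g := fun c => f (pr c))
      (ContMDiff.comp hf hprs) fun c v hv => ?_
    have h1 : v ∈ (mfderiv 𝓘(ℝ, VC) 𝓘(ℝ, VN) pr c).toLinearMap.ker := by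
      rw [hpr.ker_eq c]
      exact hv
    have h2 : mfderiv 𝓘(ℝ, VC) 𝓘(ℝ, VN) pr c v = 0 := h1
    rw [dfun_comp (hf.mdifferentiableAt _) (hprs.mdifferentiableAt (by simp)), h2, map_zero]
  refine ⟨hlift, existsUnique_quotient_poissonStructure hj.smooth P
    (D := fun c => pushSubspace k D (i c)) hDE hpr hlift hEEF hsharp fun c => ?_⟩
  obtain ⟨r, X, hX, hXD, hXc⟩ := hLie c
  obtain ⟨-, hspan, hΛ⟩ := hXc.self_of_nhds
  have hXE : ∀ a c, X a ((k ∘ i) c) ∈ E c := fun a c => hDE c (hXD a (i c))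
  refine ⟨{f | f ∈ AdaptedFun (k ∘ i) E ∧
    ∀ a b, applyVF (X b) (applyVF (X a) f) ((k ∘ i) c) = 0}, fun f hf => hf.1, ?_, ?_⟩
  · intro f hf
    obtain ⟨f₁, hf₁, hff₁⟩ := hlift f hf
    obtain ⟨f', hf', hff', hf2⟩ := exists_adaptedFun_secondDeriv_eq_zero hj hX hXE hf₁ c
      fun a b => applyVF_comm_of_isInvolutive hkr hD_inv (hX a) (hX b) (hXD a) (hXD b) hf₁.1
        fun v hv => (Submodule.mem_dualAnnihilator _).1 (hf₁.2 c) v (hDE c hv)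
    exact ⟨f', ⟨hf', hf2⟩, fun c' => (hff' c').trans (hff₁ c')⟩
  · intro f hf g hg v hv
    refine dfun_bracket_apply_eq_zero hj.smooth P hX hXE hΛ (fun ξ hξ => ?_)
      hf.1 hg.1 hf.2 hg.2 v ?_
    · have h1 := hsharp c ξ hξ
      rwa [← hspan] at h1
    · have h1 := hv
      rwa [← hspan] at h1
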